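/- Let $N>2$, let $s\in\mathbb C$ with $|s|=1$, and put $q=s^2$, $q^{1/2}=s$, $\lambda=q-q^{-1}$. For indices $a,b,\dots\in\{1,\dots,N\}$ let $a'=N+1-a$, let $\rho_a=\frac N2-a$ for $a<a'$, $\rho_a=0$ for $a=a'$, $\rho_a=-\rho_{a'}$ for $a>a'$, let $C_{ab}=C^{ab}=q^{-\rho_a}\delta_{ab'}$, and let $$R^{ab}{}_{cd}=r_{ab}\,\delta^a_c\delta^b_d+\lambda\,[a>b]\,\delta^a_d\delta^b_c-\lambda\,[a>c]\,q^{\rho_a-\rho_c}\,\delta_{ba'}\delta_{dc'},$$ where $r_{aa}=q$ and $r_{aa'}=q^{-1}$ if $a\ne a'$, and $r_{ab}=1$ in all other cases. Let $SO_q(N)$ be the complex Hopf algebra generated by the entries of $T=(T^a{}_b)$ subject to $R_{12}T_1T_2=T_2T_1R_{12}$, $TCT^t=C=T^tCT$ and $\det_qT=1$. The last relation means $T^{i_1}{}_{j_1}\cdots T^{i_N}{}_{j_N}\varepsilon^{j_1\dots j_N}=\varepsilon^{i_1\dots i_N}$ for the tensors $\varepsilon$ with $R^{ba}{}_{cd}\,\varepsilon^{\dots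 cd\dots}=-q^{-1}\varepsilon^{\dots ab\dots}$ and $C_{cd}\,\varepsilon^{\dots cd\dots}=0$ in all pairs of adjacent indices. The structure maps are $\Delta(T^a{}_b)=T^a{}_c\otimes T^c{}_b$, counit $T^a{}_b\mapsto\delta^a_b$, and antipode $\kappa(T)=CT^tC$. A star structure on a complex Hopf algebra is an antilinear antimultiplicative involution compatible with coproduct and counit. Two star structures $*,*'$ are equivalent (define isomorphic real forms) if $*'=\alpha\circ *\circ\alpha^{-1}$ for a Hopf algebra automorphism $\alpha$. There are a star structure $\times$ on $SO_q(N)$ with $T^\times=T$ and an involutive Hopf algebra automorphism $\sharp$ with $T^\sharp=\mathcal DT\mathcal D^{-1}$, where $\mathcal D=\mathrm{diag}(1,\dots,1,-1,1,\dots,1)$ ($-1$ in the middle) for $N$ odd and, for $N=2n$, $\mathcal D$ is the permutation matrix exchanging the indices $n$ and $n+1$. They commute, and $\times^\sharp=\sharp\circ\times$ is a star structure. For $s=1$ the star structures $\times,\times^\sharp$ have real points $SO(n+1,n),\,SO(n,n+1)$ if $N=2n+1$, and $SO(n,n),\,SO(n+1,n-1)$ if $N=2n$, where the signature is that of the metric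 $C$ in coordinates $x'=Mx$, $T'=MTM^{-1}$ in which the real points are the real matrices. Accordingly, $SO_q(N)$ with $\times$, respectively $\times^\sharp$, is the real form denoted $SO_q(n+1,n)$, respectively $SO_q(n,n+1)$, for $N=2n+1$, and $SO_q(n,n)$, respectively $SO_q(n+1,n-1)$, for $N=2n$. 1. Let $N$ be odd and $A=\mathrm{diag}(i,\dots,i,1,-i,\dots,-i)$. Then $\alpha(T)=ATA^{-1}$ defines a Hopf algebra automorphism of $SO_q(N)$ with $\alpha\circ\times^\sharp=\times\circ\alpha$. Hence $\times^\sharp$ and $\times$ are equivalent: the real form $SO_q(n,n+1)$ is isomorphic to $SO_q(n+1,n)$. 2. Let $\mathcal D'=\mathrm{diag}(\varepsilon_1,\dots,\varepsilon_N)$ with $\varepsilon_j^2=1$, $\varepsilon_{j'}=\varepsilon_j$, and $\varepsilon_{n+1}=1$ if $N=2n+1$, $\varepsilon_n=\varepsilon_{n+1}=1$ if $N=2n$. Then $T^\natural=\mathcal D'T\mathcal D'^{-1}$ defines an involutive Hopf algebra automorphism $\natural$ that commutes with $\times$ and $\sharp$, and $\times^\natural=\natural\circ\times$ and $\times^{\sharp\natural}=\natural\circ\sharp\circ\times$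 are star structures. Let $A=\mathrm{diag}(\sigma_1,\dots,\sigma_N)$ with $\sigma_j=1$ if $\varepsilon_j=1$, and, if $\varepsilon_j=-1$, $\sigma_j=i$ for $j<j'$ and $\sigma_j=-i$ for $j>j'$. Then $\beta(T)=ATA^{-1}$ defines a Hopf algebra automorphism with $\beta\circ\times^\natural=\times\circ\beta$ and $\beta\circ\times^{\sharp\natural}=\times^\sharp\circ\beta$. Hence $\times^\natural$ is equivalent to $\times$, $\times^{\sharp\natural}$ is equivalent to $\times^\sharp$, and, for $N$ odd, $\times^{\sharp\natural}$ is equivalent to $\times$: these conjugations give only the real forms $SO_q(n+1,n)$, $SO_q(n,n)$ and $SO_q(n+1,n-1)$. -/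

import Mathlib

open scoped TensorProduct

namespace QuantumOrthogonal

noncomputable section

/-! ### The R-matrix, the metric, the quantum epsilon tensors

Throughout, `s` is a nonzero complex number and plays the role of `q^{1/2}`, so that `q = s²`.
Indices run over `Fin N`, i.e. over `0, …, N-1`, and the primed index `a'` is `a.rev`. -/

/-- The integers `2 ρ_a`, where `ρ = (N/2-1, N/2-2, …, 1/2, 0, -1/2, …, 1-N/2)` for odd `N` and
`ρ = (N/2-1, N/2-2, …, 1, 0, 0, -1, …, 1-N/2)` for even `N`. -/
def twoRho (N : ℕ) (a : Fin N) : ℤ :=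
  if a < a.rev then (N : ℤ) - 2 * ((a : ℤ) + 1)
  else if a = a.rev then 0
  else -((N : ℤ) - 2 * ((a.rev : ℤ) + 1))

/-- The deformation parameter `q = s²`. -/
def qpar (s : ℂˣ) : ℂ := (s : ℂ) ^ 2

/-- The metric `C_{ab} = q^{-ρ_a} δ_{ab'}`; its inverse `C^{ab}` has the same matrix elements. -/
def metric (s : ℂˣ) (N : ℕ) : Matrix (Fin N) (Fin N) ℂ :=
  fun a b => if b = a.rev then ((s ^ (-twoRho N a) : ℂˣ) : ℂ) else 0

/-- The components `R^{ab}_{cd}` of the orthogonal R-matrix (first the upper indices `a b`, then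
the lower indices `c d`): the diagonal ones, plus `(q - q⁻¹)` on `R^{ab}_{ba}` for `a > b`, minus
`(q - q⁻¹) q^{ρ_a - ρ_c}` on `R^{aa'}_{cc'}` for `a > c`. -/
def Rmat (s : ℂˣ) (N : ℕ) (a b c d : Fin N) : ℂ :=
  (if a = c ∧ b = d then
      (if a = b then (if a = a.rev then 1 else qpar s)
       else if b = a.rev then (qpar s)⁻¹ else 1)
    else 0)
  + (if a = d ∧ b = c ∧ b < a then qpar s - (qpar s)⁻¹ else 0)
  - (if b = a.rev ∧ d = c.rev ∧ c < a then
      (qpar s - (qpar s)⁻¹) * ((s ^ (twoRho N a - twoRho N c) : ℂˣ) : ℂ) else 0)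

/-- `ε^{i_1 … i_N}` is a quantum epsilon tensor: it satisfies the relations of the `N`-fold products
`dx^{i_1} ⋯ dx^{i_N}` in the exterior algebra of the quantum orthogonal plane, i.e. in any two
adjacent indices it is an eigenvector of `R̂^{ab}_{cd} = R^{ba}_{cd}` with eigenvalue `-q⁻¹`, and
its contraction with the metric vanishes (it is fixed by the `q`-antisymmetrizer `P_A`). -/
structure IsQEpsilon (s : ℂˣ) (N : ℕ) (ε : (Fin N → Fin N) → ℂ) : Prop where
  antisymm : ∀ (k : ℕ) (hk : k + 1 < N) (i : Fin N → Fin N),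
    ∑ c, ∑ d, Rmat s N (i ⟨k + 1, hk⟩) (i ⟨k, Nat.lt_of_succ_lt hk⟩) c d *
      ε (Function.update (Function.update i ⟨k, Nat.lt_of_succ_lt hk⟩ c) ⟨k + 1, hk⟩ d)
      = -(qpar s)⁻¹ * ε i
  traceless : ∀ (k : ℕ) (hk : k + 1 < N) (i : Fin N → Fin N),
    ∑ c, ∑ d, metric s N c d *
      ε (Function.update (Function.update i ⟨k, Nat.lt_of_succ_lt hk⟩ c) ⟨k + 1, hk⟩ d) = 0

/-- The ordered product `t^{i_1}_{j_1} t^{i_2}_{j_2} ⋯ t^{i_K}_{j_K}`. -/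
def tens {B : Type*} [Ring B] {N K : ℕ} (t : Matrix (Fin N) (Fin N) B) (i j : Fin K → Fin N) : B :=
  (List.ofFn fun k => t (i k) (j k)).prod

/-- The defining relations of the quantum group `SO_q(N)`, for a matrix `t` with entries in an
arbitrary complex algebra: the `RTT` relations, the two orthogonality relations, and `det_q t = 1`,
the quantum determinant being given by
`t^{i_1}_{j_1} ⋯ t^{i_N}_{j_N} ε^{j_1 … j_N} = (det_q t) ε^{i_1 … i_N}`. -/
structure IsQOrth (s : ℂˣ) {N : ℕ} {B : Type*} [Ring B] [Algebra ℂ B]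
    (t : Matrix (Fin N) (Fin N) B) : Prop where
  rtt : ∀ a b c d, ∑ e, ∑ f, Rmat s N a b e f • (t e c * t f d) =
    ∑ e, ∑ f, Rmat s N e f c d • (t b f * t a e)
  orth₁ : ∀ a d, ∑ b, ∑ c, metric s N b c • (t a b * t d c) = metric s N a d • (1 : B)
  orth₂ : ∀ b d, ∑ a, ∑ c, metric s N a c • (t a b * t c d) = metric s N b d • (1 : B)
  det : ∀ ε : (Fin N → Fin N) → ℂ, IsQEpsilon s N ε → ∀ i : Fin N → Fin N,
    ∑ j, ε j • tens t i j = ε i • (1 : B)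

/-- The matrix of free generators. -/
def freeGen (N : ℕ) : Matrix (Fin N) (Fin N) (FreeAlgebra ℂ (Fin N × Fin N)) :=
  fun a b => FreeAlgebra.ι ℂ (a, b)

/-- The defining relations of `SO_q(N)` on the free algebra on the matrix entries. -/
inductive Rel (s : ℂˣ) (N : ℕ) :
    FreeAlgebra ℂ (Fin N × Fin N) → FreeAlgebra ℂ (Fin N × Fin N) → Prop
  | rtt (a b c d : Fin N) :
      Rel s N (∑ e, ∑ f, Rmat s N a b e f • (freeGen N e c * freeGen N f d))
        (∑ e, ∑ f, Rmat s N e f c d • (freeGen N b f * freeGen N a e))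
  | orth₁ (a d : Fin N) :
      Rel s N (∑ b, ∑ c, metric s N b c • (freeGen N a b * freeGen N d c)) (metric s N a d • 1)
  | orth₂ (b d : Fin N) :
      Rel s N (∑ a, ∑ c, metric s N a c • (freeGen N a b * freeGen N c d)) (metric s N b d • 1)
  | det (ε : (Fin N → Fin N) → ℂ) (hε : IsQEpsilon s N ε) (i : Fin N → Fin N) :
      Rel s N (∑ j, ε j • tens (freeGen N) i j) (ε i • 1)

/-- The algebra `SO_q(N)`, `q = s²`. -/
def SOq (s : ℂˣ) (N : ℕ) : Type := RingQuot (Rel s N)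

instance (s : ℂˣ) (N : ℕ) : Ring (SOq s N) := inferInstanceAs (Ring (RingQuot (Rel s N)))

instance (s : ℂˣ) (N : ℕ) : Algebra ℂ (SOq s N) :=
  inferInstanceAs (Algebra ℂ (RingQuot (Rel s N)))

/-- The quotient map from the free algebra. -/
def SOq.mk (s : ℂˣ) (N : ℕ) : FreeAlgebra ℂ (Fin N × Fin N) →ₐ[ℂ] SOq s N :=
  RingQuot.mkAlgHom ℂ (Rel s N)

/-- The matrix `T = (T^a_b)` of generators of `SO_q(N)`. -/
def T (s : ℂˣ) (N : ℕ) : Matrix (Fin N) (Fin N) (SOq s N) :=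
  fun a b => SOq.mk s N (freeGen N a b)

/-! ### The Hopf algebra structure -/

section Relations

set_option linter.unusedSectionVars false

variable {s : ℂˣ} {N K : ℕ} {B B' : Type*} [Ring B] [Algebra ℂ B] [Ring B'] [Algebra ℂ B']

theorem tens_zero (t : Matrix (Fin N) (Fin N) B) (i j : Fin 0 → Fin N) : tens t i j = 1 := by
  simp [tens]

theorem tens_succ (t : Matrix (Fin N) (Fin N) B) (i j : Fin (K + 1) → Fin N) :
    tens t i j = t (i 0) (j 0) * tens t (Fin.tail i) (Fin.tail j) := by
  simp [tens, List.ofFn_succ, Fin.tail]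

theorem map_tens (φ : B →ₐ[ℂ] B') (t : Matrix (Fin N) (Fin N) B) (i j : Fin K → Fin N) :
    φ (tens t i j) = tens (t.map φ) i j := by
  simp [tens, map_list_prod, List.map_ofFn, Function.comp_def]

theorem sum_cons {M : Type*} [AddCommMonoid M] (f : (Fin (K + 1) → Fin N) → M) :
    ∑ j, f j = ∑ a, ∑ j : Fin K → Fin N, f (Fin.cons a j) := by
  rw [← Fintype.sum_prod_type', ← (Fin.consEquiv fun _ => Fin N).sum_comp]
  rfl

theorem IsQOrth.map {t : Matrix (Fin N) (Fin N) B} (h : IsQOrth s t) (φ : B →ₐ[ℂ] B') :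
    IsQOrth s (t.map φ) where
  rtt a b c d := by simpa using congrArg φ (h.rtt a b c d)
  orth₁ a d := by simpa using congrArg φ (h.orth₁ a d)
  orth₂ b d := by simpa using congrArg φ (h.orth₂ b d)
  det ε hε i := by simpa [map_tens] using congrArg φ (h.det ε hε i)

theorem SOq.mk_rel {x y : FreeAlgebra ℂ (Fin N × Fin N)} (h : Rel s N x y) :
    SOq.mk s N x = SOq.mk s N y :=
  RingQuot.mkAlgHom_rel ℂ h

theorem isQOrth_T (s : ℂˣ) (N : ℕ) : IsQOrth s (T s N) where
  rtt a b c d := by simpa [T] using SOq.mk_rel (Rel.rtt (s := s) a b c d)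
  orth₁ a d := by simpa [T] using SOq.mk_rel (Rel.orth₁ (s := s) a d)
  orth₂ b d := by simpa [T] using SOq.mk_rel (Rel.orth₂ (s := s) b d)
  det ε hε i := by simpa [map_tens] using! SOq.mk_rel (Rel.det (s := s) ε hε i)

/-- A matrix satisfying the defining relations induces an algebra map out of `SO_q(N)`. -/
def SOq.lift {t : Matrix (Fin N) (Fin N) B} (h : IsQOrth s t) : SOq s N →ₐ[ℂ] B :=
  RingQuot.liftAlgHom ℂ ⟨FreeAlgebra.lift ℂ fun p => t p.1 p.2, by
    have hg : (freeGen N).map (FreeAlgebra.lift ℂ fun p : Fin N × Fin N => t p.1 p.2) = t := by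
      ext a b; simp [freeGen]
    have hg' (a b) : FreeAlgebra.lift ℂ (fun p : Fin N × Fin N => t p.1 p.2) (freeGen N a b) =
      t a b := by simp [freeGen]
    rintro _ _ (⟨a, b, c, d⟩ | ⟨a, d⟩ | ⟨b, d⟩ | ⟨ε, hε, i⟩)
    · simpa [hg'] using h.rtt a b c d
    · simpa [hg'] using h.orth₁ a d
    · simpa [hg'] using h.orth₂ b d
    · simpa [map_tens, hg] using h.det ε hε i⟩

@[simp]
theorem SOq.lift_T {t : Matrix (Fin N) (Fin N) B} (h : IsQOrth s t) (a b : Fin N) :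
    SOq.lift h (T s N a b) = t a b := by
  refine (RingQuot.liftAlgHom_mkAlgHom_apply ..).trans ?_
  simp [freeGen]

theorem SOq.algHom_ext {f g : SOq s N →ₐ[ℂ] B} (h : ∀ a b, f (T s N a b) = g (T s N a b)) :
    f = g :=
  RingQuot.ringQuot_ext' ℂ _ _ (FreeAlgebra.hom_ext (funext fun p => h p.1 p.2))

theorem SOq.induction {P : SOq s N → Prop} (alg : ∀ r, P (algebraMap ℂ _ r))
    (gen : ∀ a b, P (T s N a b)) (add : ∀ x y, P x → P y → P (x + y))
    (mul : ∀ x y, P x → P y → P (x * y)) (x : SOq s N) : P x := by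
  obtain ⟨x, rfl⟩ := RingQuot.mkAlgHom_surjective ℂ (Rel s N) x
  change P (SOq.mk s N x)
  induction x using FreeAlgebra.induction with
  | grade0 r => simpa using alg r
  | grade1 p => exact gen p.1 p.2
  | mul x y hx hy => simpa using mul _ _ hx hy
  | add x y hx hy => simpa using add _ _ hx hy

/-- `t₁ = t ⊗ 1`. -/
def leg1 (t : Matrix (Fin N) (Fin N) B) : Matrix (Fin N × Fin N) (Fin N × Fin N) B :=
  fun i j => if i.2 = j.2 then t i.1 j.1 else 0

/-- `t₂ = 1 ⊗ t`. -/
def leg2 (t : Matrix (Fin N) (Fin N) B) : Matrix (Fin N × Fin N) (Fin N × Fin N) B :=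
  fun i j => if i.1 = j.1 then t i.2 j.2 else 0

/-- The R-matrix as a matrix over `B`. -/
def RmatB (s : ℂˣ) (N : ℕ) (B : Type*) [Ring B] [Algebra ℂ B] :
    Matrix (Fin N × Fin N) (Fin N × Fin N) B :=
  fun i j => algebraMap ℂ B (Rmat s N i.1 i.2 j.1 j.2)

/-- The metric as a matrix over `B`. -/
def metricB (s : ℂˣ) (N : ℕ) (B : Type*) [Ring B] [Algebra ℂ B] : Matrix (Fin N) (Fin N) B :=
  fun a b => algebraMap ℂ B (metric s N a b)

theorem leg1_mul (t u : Matrix (Fin N) (Fin N) B) : leg1 (t * u) = leg1 t * leg1 u := by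
  ext ⟨a, b⟩ ⟨c, d⟩
  simp [leg1, Matrix.mul_apply, Fintype.sum_prod_type]

theorem leg2_mul (t u : Matrix (Fin N) (Fin N) B) : leg2 (t * u) = leg2 t * leg2 u := by
  ext ⟨a, b⟩ ⟨c, d⟩
  simp [leg2, Matrix.mul_apply, Fintype.sum_prod_type]

theorem leg1_one : leg1 (1 : Matrix (Fin N) (Fin N) B) = 1 := by
  ext ⟨a, b⟩ ⟨c, d⟩
  by_cases h : a = c <;> by_cases h' : b = d <;> simp [leg1, Matrix.one_apply, h, h']

theorem leg2_one : leg2 (1 : Matrix (Fin N) (Fin N) B) = 1 := by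
  ext ⟨a, b⟩ ⟨c, d⟩
  by_cases h : a = c <;> by_cases h' : b = d <;> simp [leg2, Matrix.one_apply, h, h']

theorem leg1_mul_leg2 (t u : Matrix (Fin N) (Fin N) B) (a b c d : Fin N) :
    (leg1 t * leg2 u) (a, b) (c, d) = t a c * u b d := by
  simp [leg1, leg2, Matrix.mul_apply, Fintype.sum_prod_type]

theorem leg2_mul_leg1 (t u : Matrix (Fin N) (Fin N) B) (a b c d : Fin N) :
    (leg2 t * leg1 u) (a, b) (c, d) = t b d * u a c := by
  simp [leg1, leg2, Matrix.mul_apply, Fintype.sum_prod_type]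

theorem rtt_iff (t : Matrix (Fin N) (Fin N) B) :
    (∀ a b c d, ∑ e, ∑ f, Rmat s N a b e f • (t e c * t f d) =
      ∑ e, ∑ f, Rmat s N e f c d • (t b f * t a e)) ↔
    RmatB s N B * (leg1 t * leg2 t) = leg2 t * leg1 t * RmatB s N B := by
  have h1 (a b c d) : (RmatB s N B * (leg1 t * leg2 t)) (a, b) (c, d) =
      ∑ e, ∑ f, Rmat s N a b e f • (t e c * t f d) := by
    rw [Matrix.mul_apply, Fintype.sum_prod_type]
    simp only [leg1_mul_leg2, RmatB, Algebra.smul_def]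
  have h2 (a b c d) : (leg2 t * leg1 t * RmatB s N B) (a, b) (c, d) =
      ∑ e, ∑ f, Rmat s N e f c d • (t b f * t a e) := by
    rw [Matrix.mul_apply, Fintype.sum_prod_type]
    simp only [leg2_mul_leg1, RmatB, Algebra.smul_def, Algebra.commutes]
  constructor
  · intro h
    ext ⟨a, b⟩ ⟨c, d⟩
    rw [h1, h2, h]
  · intro h a b c d
    rw [← h1, ← h2, h]

theorem orth₁_iff (t : Matrix (Fin N) (Fin N) B) :
    (∀ a d, ∑ b, ∑ c, metric s N b c • (t a b * t d c) = metric s N a d • (1 : B)) ↔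
    t * (metricB s N B * t.transpose) = metricB s N B := by
  rw [← Matrix.ext_iff]
  refine forall₂_congr fun a d => ?_
  simp only [Matrix.mul_apply, metricB, Matrix.transpose_apply, Finset.mul_sum, Algebra.smul_def,
    mul_one]
  simp only [← mul_assoc]
  simp only [← Algebra.commutes (metric s N _ _) (t _ _)]

theorem orth₂_iff (t : Matrix (Fin N) (Fin N) B) :
    (∀ b d, ∑ a, ∑ c, metric s N a c • (t a b * t c d) = metric s N b d • (1 : B)) ↔
    t.transpose * (metricB s N B * t) = metricB s N B := by
  rw [← Matrix.ext_iff]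
  refine forall₂_congr fun a d => ?_
  simp only [Matrix.mul_apply, metricB, Matrix.transpose_apply, Finset.mul_sum, Algebra.smul_def,
    mul_one]
  simp only [← mul_assoc]
  simp only [← Algebra.commutes (metric s N _ _) (t _ _)]

theorem twoRho_rev (a : Fin N) : twoRho N a.rev = -twoRho N a := by
  unfold twoRho
  rcases lt_trichotomy a a.rev with h | h | h
  · simp [h, h.not_gt, h.ne']
  · rw [← h]; simp [← h]
  · simp [h, h.not_gt, h.ne']

theorem metric_rev (a : Fin N) : metric s N a a.rev * metric s N a.rev a = 1 := by
  simp [metric, twoRho_rev, inv_mul_cancel₀ (zpow_ne_zero _ s.ne_zero)]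

theorem metric_mul_metric : metric s N * metric s N = 1 := by
  ext a b
  rw [Matrix.mul_apply, Finset.sum_eq_single a.rev]
  · by_cases h : a = b
    · subst h; simpa using metric_rev a
    · have : b ≠ a.rev.rev := by simpa using Ne.symm h
      simp [metric, h, Ne.symm h]
  · intro c _ hc; simp [metric, hc]
  · simp

theorem metricB_mul_metricB : metricB s N B * metricB s N B = 1 := by
  have : metricB s N B = (metric s N).map (algebraMap ℂ B) := rfl
  rw [this, ← Matrix.map_mul, metric_mul_metric]
  simp

theorem tens_mul {t u : Matrix (Fin N) (Fin N) B} (h : ∀ a b c d, Commute (t a b) (u c d))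
    (i j : Fin K → Fin N) : tens (t * u) i j = ∑ m, tens t i m * tens u m j := by
  induction K with
  | zero => simp [tens_zero]
  | succ K ih =>
    have hc (a b) (i j : Fin K → Fin N) : Commute (u a b) (tens t i j) :=
      Commute.list_prod_right _ _ fun x hx => by
        obtain ⟨k, rfl⟩ := List.mem_ofFn.1 hx
        exact (h _ _ _ _).symm
    rw [tens_succ, ih, Matrix.mul_apply, Finset.sum_mul_sum, sum_cons]
    refine Finset.sum_congr rfl fun a _ => Finset.sum_congr rfl fun m _ => ?_
    rw [tens_succ, tens_succ]
    simp only [Fin.cons_zero, Fin.tail_cons]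
    rw [mul_assoc, ← mul_assoc (u a (j 0)), (hc _ _ _ _).eq]
    simp only [mul_assoc]

theorem IsQOrth.mul {t u : Matrix (Fin N) (Fin N) B} (ht : IsQOrth s t) (hu : IsQOrth s u)
    (h : ∀ a b c d, Commute (t a b) (u c d)) : IsQOrth s (t * u) where
  rtt := by
    have h1 := (rtt_iff t).1 ht.rtt
    have h2 := (rtt_iff u).1 hu.rtt
    have h12 : leg1 u * leg2 t = leg2 t * leg1 u := by
      ext ⟨a, b⟩ ⟨c, d⟩
      rw [leg1_mul_leg2, leg2_mul_leg1, (h _ _ _ _).eq]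
    have h21 : leg1 t * leg2 u = leg2 u * leg1 t := by
      ext ⟨a, b⟩ ⟨c, d⟩
      rw [leg1_mul_leg2, leg2_mul_leg1, (h _ _ _ _).eq]
    rw [rtt_iff, leg1_mul, leg2_mul]
    calc RmatB s N B * (leg1 t * leg1 u * (leg2 t * leg2 u))
        = RmatB s N B * (leg1 t * (leg1 u * leg2 t) * leg2 u) := by simp only [mul_assoc]
      _ = (RmatB s N B * (leg1 t * leg2 t)) * (leg1 u * leg2 u) := by
          rw [h12]; simp only [mul_assoc]
      _ = leg2 t * leg1 t * (RmatB s N B * (leg1 u * leg2 u)) := by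
          rw [h1]; simp only [mul_assoc]
      _ = leg2 t * (leg1 t * leg2 u) * leg1 u * RmatB s N B := by
          rw [h2]; simp only [mul_assoc]
      _ = _ := by rw [h21]; simp only [mul_assoc]
  orth₁ := by
    have h1 := (orth₁_iff t).1 ht.orth₁
    have h2 := (orth₁_iff u).1 hu.orth₁
    have h3 : (t * u).transpose = u.transpose * t.transpose := by
      ext a b
      simp only [Matrix.transpose_apply, Matrix.mul_apply]
      exact Finset.sum_congr rfl fun c _ => (h _ _ _ _).eq
    rw [orth₁_iff, h3]
    calc t * u * (metricB s N B * (u.transpose * t.transpose))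
        = t * ((u * (metricB s N B * u.transpose)) * t.transpose) := by simp only [mul_assoc]
      _ = _ := by rw [h2, h1]
  orth₂ := by
    have h1 := (orth₂_iff t).1 ht.orth₂
    have h2 := (orth₂_iff u).1 hu.orth₂
    have h3 : (t * u).transpose = u.transpose * t.transpose := by
      ext a b
      simp only [Matrix.transpose_apply, Matrix.mul_apply]
      exact Finset.sum_congr rfl fun c _ => (h _ _ _ _).eq
    rw [orth₂_iff, h3]
    calc u.transpose * t.transpose * (metricB s N B * (t * u))
        = u.transpose * ((t.transpose * (metricB s N B * t)) * u) := by simp only [mul_assoc]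
      _ = _ := by rw [h1, h2]
  det ε hε i := by
    simp only [tens_mul h, Finset.smul_sum]
    rw [Finset.sum_comm]
    simp only [← mul_smul_comm]
    simp only [← Finset.mul_sum, hu.det ε hε]
    simp only [mul_smul_comm, mul_one, ht.det ε hε]

/-- The identity matrix satisfies the defining relations. -/
theorem isQOrth_one (s : ℂˣ) (N : ℕ) : IsQOrth s (1 : Matrix (Fin N) (Fin N) ℂ) where
  rtt := by rw [rtt_iff, leg1_one, leg2_one]; simp
  orth₁ := by rw [orth₁_iff]; simp
  orth₂ := by rw [orth₂_iff]; simp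
  det ε _ i := by
    have h (K : ℕ) (i j : Fin K → Fin N) :
        tens (1 : Matrix (Fin N) (Fin N) ℂ) i j = if i = j then 1 else 0 := by
      induction K with
      | zero => simp [tens_zero, Subsingleton.elim i j]
      | succ K ih =>
        have hij : i = j ↔ i 0 = j 0 ∧ Fin.tail i = Fin.tail j := by
          refine ⟨by rintro rfl; simp, fun ⟨h1, h2⟩ => ?_⟩
          rw [← Fin.cons_self_tail i, h1, h2, Fin.cons_self_tail]
        rw [tens_succ, ih, Matrix.one_apply]
        by_cases h1 : i 0 = j 0 <;> by_cases h2 : Fin.tail i = Fin.tail j <;> simp [hij, h1, h2]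
    simp [h]

/-- The matrix `κ(T) = C Tᵗ C`. -/
def antipodeMatrix (s : ℂˣ) (t : Matrix (Fin N) (Fin N) B) : Matrix (Fin N) (Fin N) B :=
  metricB s N B * t.transpose * metricB s N B

theorem IsQOrth.antipode_mul {t : Matrix (Fin N) (Fin N) B} (h : IsQOrth s t) :
    antipodeMatrix s t * t = 1 := by
  have := (orth₂_iff t).1 h.orth₂
  rw [antipodeMatrix, mul_assoc, mul_assoc, this, metricB_mul_metricB]

theorem IsQOrth.mul_antipode {t : Matrix (Fin N) (Fin N) B} (h : IsQOrth s t) :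
    t * antipodeMatrix s t = 1 := by
  have := (orth₁_iff t).1 h.orth₁
  rw [antipodeMatrix, ← mul_assoc, this, metricB_mul_metricB]

theorem antipodeMatrix_transpose (t : Matrix (Fin N) (Fin N) B) :
    (antipodeMatrix s t).transpose = (metricB s N B).transpose * t * (metricB s N B).transpose := by
  ext a b
  simp only [antipodeMatrix, Matrix.transpose_apply, Matrix.mul_apply, metricB, Finset.sum_mul]
  rw [Finset.sum_comm]
  refine Finset.sum_congr rfl fun c _ => Finset.sum_congr rfl fun d _ => ?_
  rw [← Algebra.commutes, ← Algebra.commutes, ← mul_assoc, ← mul_assoc, ← map_mul, ← map_mul,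
    mul_comm]

theorem tens_antipode {t S : Matrix (Fin N) (Fin N) B} (h : S * t = 1) (i j : Fin K → Fin N) :
    ∑ m, (tens (S.map MulOpposite.op) i m).unop * tens t m j = if i = j then 1 else 0 := by
  induction K with
  | zero => simp [tens_zero, Subsingleton.elim i j]
  | succ K ih =>
    have hij : i = j ↔ i 0 = j 0 ∧ Fin.tail i = Fin.tail j := by
      refine ⟨by rintro rfl; simp, fun ⟨h1, h2⟩ => ?_⟩
      rw [← Fin.cons_self_tail i, h1, h2, Fin.cons_self_tail]
    have h0 : ∑ a, S (i 0) a * t a (j 0) = if i 0 = j 0 then 1 else 0 := by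
      rw [← Matrix.mul_apply, h, Matrix.one_apply]
    rw [sum_cons, Finset.sum_comm]
    simp only [tens_succ, Fin.cons_zero, Fin.tail_cons, MulOpposite.unop_mul, Matrix.map_apply,
      MulOpposite.unop_op, mul_assoc]
    simp only [← mul_assoc (S _ _), ← Finset.mul_sum, ← Finset.sum_mul, h0]
    by_cases h1 : i 0 = j 0
    · simp [h1, ih, hij]
    · simp [h1, hij]

theorem IsQOrth.antipode {t : Matrix (Fin N) (Fin N) B} (h : IsQOrth s t) :
    IsQOrth s ((antipodeMatrix s t).map MulOpposite.op) := by
  have hSt := h.antipode_mul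
  have htS := h.mul_antipode
  have hT := antipodeMatrix_transpose (s := s) t
  have hCt : (metricB s N B).transpose * (metricB s N B).transpose = 1 := by
    have := congrArg Matrix.transpose (metric_mul_metric (s := s) (N := N))
    rw [Matrix.transpose_mul, Matrix.transpose_one] at this
    have h' : (metricB s N B).transpose = ((metric s N).transpose).map (algebraMap ℂ B) := rfl
    rw [h', ← Matrix.map_mul, this]
    simp
  have hC := metricB_mul_metricB (s := s) (N := N) (B := B)
  have h1 := (orth₁_iff t).1 h.orth₁
  have h2 := (orth₂_iff t).1 h.orth₂
  set S := antipodeMatrix s t with hS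
  refine ⟨fun a b c d => ?_, fun a d => ?_, fun b d => ?_, fun ε hε i => ?_⟩
  · have hrtt := (rtt_iff t).1 h.rtt
    have a1 : leg1 S * leg1 t = 1 := by rw [← leg1_mul, hSt, leg1_one]
    have a2 : leg2 S * leg2 t = 1 := by rw [← leg2_mul, hSt, leg2_one]
    have b1 : leg1 t * leg1 S = 1 := by rw [← leg1_mul, htS, leg1_one]
    have b2 : leg2 t * leg2 S = 1 := by rw [← leg2_mul, htS, leg2_one]
    have key : RmatB s N B * (leg2 S * leg1 S) = leg1 S * leg2 S * RmatB s N B := by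
      calc RmatB s N B * (leg2 S * leg1 S)
          = leg1 S * ((leg2 S * leg2 t) * leg1 t) * RmatB s N B * (leg2 S * leg1 S) := by
            rw [a2, one_mul, a1, one_mul]
        _ = leg1 S * leg2 S * (leg2 t * leg1 t * RmatB s N B) * (leg2 S * leg1 S) := by
            simp only [mul_assoc]
        _ = leg1 S * leg2 S * RmatB s N B * (leg1 t * (leg2 t * leg2 S) * leg1 S) := by
            rw [← hrtt]; simp only [mul_assoc]
        _ = _ := by rw [b2, mul_one, b1, mul_one]
    have := congrFun (congrFun key (a, b)) (c, d)
    rw [Matrix.mul_apply, Matrix.mul_apply, Fintype.sum_prod_type, Fintype.sum_prod_type] at this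
    simp only [leg1_mul_leg2, leg2_mul_leg1, RmatB, ← Algebra.commutes, ← Algebra.smul_def] at this
    simpa using congrArg MulOpposite.op this
  · have key : S * ((metricB s N B).transpose * S.transpose) = (metricB s N B).transpose := by
      calc _ = metricB s N B * t.transpose * metricB s N B *
            (((metricB s N B).transpose * (metricB s N B).transpose) * t *
              (metricB s N B).transpose) := by
              rw [hT, hS, antipodeMatrix]; simp only [mul_assoc]
        _ = metricB s N B * (t.transpose * (metricB s N B * t)) * (metricB s N B).transpose := by
              rw [hCt]; simp only [mul_assoc, one_mul]
        _ = _ := by rw [h2, hC, one_mul]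
    have := congrFun (congrFun key d) a
    simp only [Matrix.mul_apply, metricB, Matrix.transpose_apply, Finset.mul_sum] at this
    rw [Finset.sum_comm] at this
    simp only [← mul_assoc, ← Algebra.commutes (metric s N _ _) (S _ _)] at this
    simp only [← Algebra.smul_def] at this
    simpa [Algebra.algebraMap_eq_smul_one] using congrArg MulOpposite.op this
  · have key : S.transpose * ((metricB s N B).transpose * S) = (metricB s N B).transpose := by
      calc _ = (metricB s N B).transpose * t * ((metricB s N B).transpose *
              (metricB s N B).transpose) * S := by
              rw [hT]; simp only [mul_assoc]
        _ = _ := by rw [hCt, mul_one, mul_assoc, htS, mul_one]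
    have := congrFun (congrFun key d) b
    simp only [Matrix.mul_apply, metricB, Matrix.transpose_apply, Finset.mul_sum] at this
    rw [Finset.sum_comm] at this
    simp only [← mul_assoc, ← Algebra.commutes (metric s N _ _) (S _ _)] at this
    simp only [← Algebra.smul_def] at this
    simpa [Algebra.algebraMap_eq_smul_one] using congrArg MulOpposite.op this
  · apply MulOpposite.unop_injective
    have hd := h.det ε hε
    calc (∑ m, ε m • tens (S.map MulOpposite.op) i m).unop
        = ∑ m, (tens (S.map MulOpposite.op) i m).unop * (ε m • (1 : B)) := by simp
      _ = ∑ j, ε j • ∑ m, (tens (S.map MulOpposite.op) i m).unop * tens t m j := by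
          simp only [← hd, Finset.mul_sum, Finset.smul_sum, mul_smul_comm]
          rw [Finset.sum_comm]
      _ = _ := by simp [tens_antipode hSt]

end Relations

section Hopf

variable (s : ℂˣ) (N : ℕ)

/-- The coproduct `Δ(T^a_b) = T^a_c ⊗ T^c_b`. -/
def comulHom : SOq s N →ₐ[ℂ] SOq s N ⊗[ℂ] SOq s N :=
  SOq.lift (t := (T s N).map (Algebra.TensorProduct.includeLeft (R := ℂ) (S := ℂ) (B := SOq s N)) *
    (T s N).map (Algebra.TensorProduct.includeRight (R := ℂ) (A := SOq s N)))
    (((isQOrth_T s N).map _).mul ((isQOrth_T s N).map _) fun a b c d => by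
      simp [Commute, SemiconjBy])

/-- The counit `ε(T^a_b) = δ^a_b`. -/
def counitHom : SOq s N →ₐ[ℂ] ℂ := SOq.lift (isQOrth_one s N)

/-- The antipode `κ(T) = C Tᵗ C`, as an algebra map to the opposite algebra. -/
def antipodeHom : SOq s N →ₐ[ℂ] (SOq s N)ᵐᵒᵖ := SOq.lift (isQOrth_T s N).antipode

theorem comulHom_T (a b : Fin N) :
    comulHom s N (T s N a b) = ∑ c, T s N a c ⊗ₜ[ℂ] T s N c b := by
  simp [comulHom, Matrix.mul_apply]

theorem counitHom_T (a b : Fin N) : counitHom s N (T s N a b) = if a = b then 1 else 0 := by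
  simp [counitHom, Matrix.one_apply]

theorem antipodeHom_T (a b : Fin N) :
    antipodeHom s N (T s N a b) = MulOpposite.op (antipodeMatrix s (T s N) a b) := by
  simp [antipodeHom]

instance : Bialgebra ℂ (SOq s N) :=
  Bialgebra.ofAlgHom (comulHom s N) (counitHom s N)
    (by
      apply SOq.algHom_ext
      intro a b
      simp [comulHom_T, TensorProduct.sum_tmul, TensorProduct.tmul_sum]
      rw [Finset.sum_comm])
    (by
      apply SOq.algHom_ext
      intro a b
      simp [comulHom_T, counitHom_T, TensorProduct.ite_tmul])
    (by
      apply SOq.algHom_ext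
      intro a b
      simp [comulHom_T, counitHom_T, TensorProduct.tmul_ite])

theorem comul_T (a b : Fin N) :
    Coalgebra.comul (R := ℂ) (T s N a b) = ∑ c, T s N a c ⊗ₜ[ℂ] T s N c b :=
  comulHom_T s N a b

theorem counit_T (a b : Fin N) :
    Coalgebra.counit (R := ℂ) (T s N a b) = if a = b then 1 else 0 :=
  counitHom_T s N a b

/-- The antipode as a linear map. -/
def antipodeLin : SOq s N →ₗ[ℂ] SOq s N :=
  (MulOpposite.opLinearEquiv ℂ).symm.toLinearMap ∘ₗ (antipodeHom s N).toLinearMap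

theorem antipodeLin_mul (x y : SOq s N) :
    antipodeLin s N (x * y) = antipodeLin s N y * antipodeLin s N x := by
  simp [antipodeLin]

theorem antipodeLin_T (a b : Fin N) :
    antipodeLin s N (T s N a b) = antipodeMatrix s (T s N) a b := by
  simp [antipodeLin, antipodeHom_T]

theorem antipodeLin_one : antipodeLin s N 1 = 1 := by simp [antipodeLin]

theorem antipodeLin_algebraMap (r : ℂ) :
    antipodeLin s N (algebraMap ℂ _ r) = algebraMap ℂ _ r := by
  simp [antipodeLin]

theorem antipode_aux_left (z w : SOq s N ⊗[ℂ] SOq s N) (r : ℂ)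
    (hz : LinearMap.mul' ℂ _ ((antipodeLin s N).rTensor _ z) = algebraMap ℂ _ r) :
    LinearMap.mul' ℂ _ ((antipodeLin s N).rTensor _ (z * w)) =
      algebraMap ℂ _ r * LinearMap.mul' ℂ _ ((antipodeLin s N).rTensor _ w) := by
  induction w using TensorProduct.induction_on with
  | zero => simp
  | add w w' h h' => simp only [mul_add, map_add, h, h']
  | tmul p q =>
    have key : LinearMap.mul' ℂ _ ((antipodeLin s N).rTensor _ (z * p ⊗ₜ[ℂ] q)) =
        antipodeLin s N p * LinearMap.mul' ℂ _ ((antipodeLin s N).rTensor _ z) * q := by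
      clear hz
      induction z using TensorProduct.induction_on with
      | zero => simp
      | add z z' h h' => simp only [add_mul, mul_add, map_add, h, h']
      | tmul a b => simp [antipodeLin_mul, mul_assoc]
    rw [key, hz, ← Algebra.commutes]
    simp [mul_assoc]

theorem antipode_aux_right (z w : SOq s N ⊗[ℂ] SOq s N) (r : ℂ)
    (hw : LinearMap.mul' ℂ _ ((antipodeLin s N).lTensor _ w) = algebraMap ℂ _ r) :
    LinearMap.mul' ℂ _ ((antipodeLin s N).lTensor _ (z * w)) =
      LinearMap.mul' ℂ _ ((antipodeLin s N).lTensor _ z) * algebraMap ℂ _ r := by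
  induction z using TensorProduct.induction_on with
  | zero => simp
  | add z z' h h' => simp only [add_mul, map_add, h, h']
  | tmul p q =>
    have key : LinearMap.mul' ℂ _ ((antipodeLin s N).lTensor _ (p ⊗ₜ[ℂ] q * w)) =
        p * LinearMap.mul' ℂ _ ((antipodeLin s N).lTensor _ w) * antipodeLin s N q := by
      clear hw
      induction w using TensorProduct.induction_on with
      | zero => simp
      | add w w' h h' => simp only [add_mul, mul_add, map_add, h, h']
      | tmul a b => simp [antipodeLin_mul, mul_assoc]
    rw [key, hw, mul_assoc, Algebra.commutes, ← mul_assoc]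
    simp

instance : HopfAlgebra ℂ (SOq s N) where
  antipode := antipodeLin s N
  mul_antipode_rTensor_comul := by
    ext x
    induction x using SOq.induction with
    | alg r => simp [antipodeLin_algebraMap, Algebra.TensorProduct.algebraMap_apply]
    | gen a b =>
      simp only [LinearMap.comp_apply, comul_T, counit_T, map_sum, LinearMap.rTensor_tmul,
        antipodeLin_T, LinearMap.mul'_apply]
      rw [← Matrix.mul_apply, (isQOrth_T s N).antipode_mul, Matrix.one_apply]
      split_ifs <;> simp
    | add x y hx hy => rw [map_add, map_add, hx, hy]
    | mul x y hx hy =>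
      simp only [LinearMap.comp_apply] at hx hy ⊢
      rw [Bialgebra.comul_mul, antipode_aux_left s N _ _ _ hx, hy]
      simp
  mul_antipode_lTensor_comul := by
    ext x
    induction x using SOq.induction with
    | alg r => simp [antipodeLin_one, Algebra.TensorProduct.algebraMap_apply]
    | gen a b =>
      simp only [LinearMap.comp_apply, comul_T, counit_T, map_sum, LinearMap.lTensor_tmul,
        antipodeLin_T, LinearMap.mul'_apply]
      rw [← Matrix.mul_apply, (isQOrth_T s N).mul_antipode, Matrix.one_apply]
      split_ifs <;> simp
    | add x y hx hy => rw [map_add, map_add, hx, hy]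
    | mul x y hx hy =>
      simp only [LinearMap.comp_apply] at hx hy ⊢
      rw [Bialgebra.comul_mul, antipode_aux_right s N _ _ _ hy, hx]
      simp

end Hopf

/-! ### Star structures on complex Hopf algebras -/

/-- A star structure (conjugation) on a complex Hopf algebra: an antilinear, antimultiplicative
involution compatible with the coproduct and the counit. -/
structure HopfStar (A : Type*) [Ring A] [HopfAlgebra ℂ A] where
  toMap : A →ₛₗ[starRingEnd ℂ] A
  antimul : ∀ x y, toMap (x * y) = toMap y * toMap x
  comul_star : ∀ x, Coalgebra.comul (R := ℂ) (toMap x) =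
    TensorProduct.map toMap toMap (Coalgebra.comul (R := ℂ) x)
  counit_star : ∀ x, Coalgebra.counit (R := ℂ) (toMap x) =
    starRingEnd ℂ (Coalgebra.counit (R := ℂ) x)
  invol : ∀ x, toMap (toMap x) = x

instance (A : Type*) [Ring A] [HopfAlgebra ℂ A] : CoeFun (HopfStar A) fun _ => A → A :=
  ⟨fun σ => σ.toMap⟩

/-- A Hopf algebra automorphism: a bialgebra automorphism compatible with the antipode. -/
structure HopfAut (A : Type*) [Ring A] [HopfAlgebra ℂ A] where
  toEquiv : A ≃ₐc[ℂ] A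
  antipode_comm : ∀ x, HopfAlgebra.antipode ℂ (toEquiv x) = toEquiv (HopfAlgebra.antipode ℂ x)

instance (A : Type*) [Ring A] [HopfAlgebra ℂ A] : CoeFun (HopfAut A) fun _ => A → A :=
  ⟨fun φ => φ.toEquiv⟩

/-- Two star structures `σ`, `τ` are equivalent, i.e. define isomorphic real forms, if
`τ = α ∘ σ ∘ α⁻¹` for some Hopf algebra automorphism `α`. -/
def HopfStar.Equivalent {A : Type*} [Ring A] [HopfAlgebra ℂ A] (σ τ : HopfStar A) : Prop :=
  ∃ α : HopfAut A, ∀ x, τ x = α (σ (α.toEquiv.symm x))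

section Forms

variable {s : ℂˣ} {N : ℕ}

/-- A self-map of `SO_q(N)` acts on the generators by `T ↦ E T E⁻¹`, i.e.
`T^a_b ↦ E^a_c T^c_d (E⁻¹)^d_b`. -/
def ActsBy (f : SOq s N → SOq s N) (E : Matrix (Fin N) (Fin N) ℂ) : Prop :=
  ∀ a b, f (T s N a b) = ∑ c, ∑ d, (E a c * E⁻¹ d b) • T s N c d

/-- The real points of the (classical) group on which `T^a_b` are coordinates, with respect to a
star structure: the matrices `g = χ(T)`, for `χ` a character with `χ(f^*)` the complex conjugate
of `χ(f)` for all `f`. -/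
def HopfStar.realPoints (σ : HopfStar (SOq s N)) : Set (Matrix (Fin N) (Fin N) ℂ) :=
  {g | ∃ χ : SOq s N →ₐ[ℂ] ℂ, (∀ f, χ (σ f) = starRingEnd ℂ (χ f)) ∧ ∀ a b, χ (T s N a b) = g a b}

/-- The group `SO(l, m)` of real matrices of determinant one preserving `diag(1_l, -1_m)`. -/
def SOlm (l m : ℕ) : Set (Matrix (Fin l ⊕ Fin m) (Fin l ⊕ Fin m) ℝ) :=
  {h | h.transpose * LieAlgebra.Orthogonal.indefiniteDiagonal (Fin l) (Fin m) ℝ * h =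
      LieAlgebra.Orthogonal.indefiniteDiagonal (Fin l) (Fin m) ℝ ∧ h.det = 1}

/-- A star structure is a real form of signature `(l, m)`: there is a complex linear change of
coordinates `x' = M x`, `T' = M T M⁻¹` such that the metric `C' = (M⁻¹)ᵗ C M⁻¹` is
`diag(1_l, -1_m)` and the real points, in the new coordinates, are the elements of `SO(l, m)`.
To be used in the classical case `s = 1`. -/
def HopfStar.IsClassicalForm (σ : HopfStar (SOq s N)) (l m : ℕ) : Prop :=
  ∃ (M : Matrix (Fin l ⊕ Fin m) (Fin N) ℂ) (M' : Matrix (Fin N) (Fin l ⊕ Fin m) ℂ),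
    M * M' = 1 ∧ M' * M = 1 ∧
    M'.transpose * metric s N * M' =
      LieAlgebra.Orthogonal.indefiniteDiagonal (Fin l) (Fin m) ℂ ∧
    σ.realPoints = (fun h => M' * h.map Complex.ofReal * M) '' SOlm l m

end Forms

/-! ### The matrices of the automorphisms -/

/-- The middle indices: `n₂` for `N = 2n+1`, and the two indices `n`, `n' = n+1` (counted from one)
for `N = 2n`. -/
def IsMiddle {N : ℕ} (a : Fin N) : Prop := (a : ℕ) ≤ a.rev + 1 ∧ (a.rev : ℕ) ≤ a + 1

open Classical in
/-- The matrix `𝒟` of `♯`: for odd `N` it is `diag(1, …, 1, -1, 1, …, 1)` with `-1` in the middle;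
for even `N` it is the permutation matrix that exchanges the two middle indices. -/
def sharpMatrix (N : ℕ) : Matrix (Fin N) (Fin N) ℂ := fun a b =>
  if IsMiddle a then
    (if Odd N then (if b = a then -1 else 0) else (if b = a.rev then 1 else 0))
  else (if b = a then 1 else 0)

/-- The matrix `A = diag(i, …, i, 1, -i, …, -i)` (the entry `1` is present for odd `N`). -/
def alphaMatrix (N : ℕ) : Matrix (Fin N) (Fin N) ℂ :=
  Matrix.diagonal fun a => if a < a.rev then Complex.I else if a = a.rev then 1 else -Complex.I

/-- The signs allowed in the matrices `𝒟' = diag(ε_1, …, ε_N)` of the automorphisms `♮`. -/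
structure IsSigns {N : ℕ} (ε : Fin N → ℂ) : Prop where
  sq : ∀ a, ε a ^ 2 = 1
  rev : ∀ a, ε a.rev = ε a
  middle : ∀ a, IsMiddle a → ε a = 1

open Classical in
/-- The matrix `A = diag(σ(ε_1), …, σ(ε_N))`, where `σ(ε_j) = 1` if `ε_j = 1`, and if `ε_j = -1`,
`σ(ε_j) = i` for `j < j'` and `σ(ε_j) = -i` for `j > j'`. -/
def sigmaMatrix {N : ℕ} (ε : Fin N → ℂ) : Matrix (Fin N) (Fin N) ℂ :=
  Matrix.diagonal fun a => if ε a = 1 then 1 else if a < a.rev then Complex.I else -Complex.I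

end

end QuantumOrthogonal

/-! `SOq s N` is given by generators and relations. A map on it therefore exists once the image of T
satisfies `IsQOrth`, and two such maps agree once they agree on T. Everything rests on three checks
of the relations and a few scalar identities.

For `×`, read an antilinear antimultiplicative map as an algebra map into `ConjOp`. Conjugating and
reversing R T₁T₂ = T₂T₁ R gives a relation with the conjugate of R, which for |s| = 1 is R with q
replaced by q⁻¹ (`conj_Rmat`). This is the RTT relation again because R(q⁻¹) = R(q)⁻¹
(`RmatB_mul_RmatB_inv`). That identity is proved entrywise; its one nontrivial entry is a
telescoping sum of powers of q. The metric is hermitian, and the reversed conjugate of an epsilon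
tensor is an epsilon tensor, which settles the orthogonality and determinant relations
(`isQOrth_conj`).

The automorphisms are all T ↦ E T E⁻¹ with E monomial and preserving R and C (`IsMonomialSymm`).
Diagonal E qualify as soon as e_a e_{a'} = 1. Exchanging the two middle indices for even N qualifies
because the order-dependent terms of R on the middle pair cancel (`Rmat_sharpPerm`).

Conjugating a star structure T ↦ D T D⁻¹ by a diagonal A turns it into × precisely when, entrywise,
DA and the conjugate of A define the same conjugation. The weights i and -i are chosen to achieve
this: DA is minus the conjugate of A in `exists_alpha`, where the sign drops out of the conjugation,
and equal to the conjugate of A in `exists_natural`.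

At s = 1, R is the identity and the epsilon tensors are the multiples of the Levi-Civita symbol, so
the characters are the points of SO(N, ℂ) for the metric C (`isQOrth_classical_iff`). A star
structure acting by E imposes that the conjugate of g be E g E; a C-orthonormal basis whose
conjugate is its image under E identifies these g with a real SO(l, m) (`isClassicalForm_of_basis`).
-/

namespace QuantumOrthogonal

noncomputable section

/-! ### The inverse of the R-matrix -/

section Inverse

variable {s : ℂˣ} {N : ℕ}

/-- The number `q^{ρ_a}`. -/
def qrho (s : ℂˣ) (a : Fin N) : ℂ := ((s ^ twoRho N a : ℂˣ) : ℂ)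

/-- The diagonal components `R^{ab}_{ab}`. -/
def rdiag (s : ℂˣ) (a b : Fin N) : ℂ :=
  if a = b then (if a = a.rev then 1 else qpar s) else if b = a.rev then (qpar s)⁻¹ else 1

theorem qpar_ne_zero (s : ℂˣ) : qpar s ≠ 0 := pow_ne_zero _ s.ne_zero

theorem qpar_inv (s : ℂˣ) : qpar s⁻¹ = (qpar s)⁻¹ := by simp [qpar]

theorem qrho_ne_zero (s : ℂˣ) (a : Fin N) : qrho s a ≠ 0 := Units.ne_zero _

theorem qrho_inv (s : ℂˣ) (a : Fin N) : qrho s⁻¹ a = (qrho s a)⁻¹ := by simp [qrho]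

theorem qrho_rev (s : ℂˣ) (a : Fin N) : qrho s a.rev = (qrho s a)⁻¹ := by
  simp [qrho, twoRho_rev]

theorem qrho_of_eq_rev (s : ℂˣ) {a : Fin N} (h : a = a.rev) : qrho s a = 1 := by
  have : twoRho N a = 0 := by unfold twoRho; rw [← h]; simp
  simp [qrho, this]

theorem Rmat_eq (s : ℂˣ) (a b c d : Fin N) : Rmat s N a b c d =
    (if a = c ∧ b = d then rdiag s a b else 0)
    + (if a = d ∧ b = c ∧ b < a then qpar s - (qpar s)⁻¹ else 0)
    - (if b = a.rev ∧ d = c.rev ∧ c < a then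
      (qpar s - (qpar s)⁻¹) * (qrho s a * (qrho s c)⁻¹) else 0) := by
  simp only [Rmat, rdiag, qrho, zpow_sub, Units.val_mul, Units.val_inv_eq_inv_val]

/-- Each row of R has a diagonal part, a flip part, and a metric part supported on b = a'. Only the
metric part leaves a genuine sum, so all later contractions reduce to that one. -/
theorem sum_Rmat (s : ℂˣ) (a b : Fin N) (v : Fin N → Fin N → ℂ) :
    ∑ e, ∑ f, Rmat s N a b e f * v e f = rdiag s a b * v a b
      + (if b < a then (qpar s - (qpar s)⁻¹) * v b a else 0)
      - (if b = a.rev then ∑ e, (if e < a then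
          (qpar s - (qpar s)⁻¹) * (qrho s a * (qrho s e)⁻¹) * v e e.rev else 0) else 0) := by
  simp only [Rmat_eq, add_mul, sub_mul, ite_mul, zero_mul, Finset.sum_add_distrib,
    Finset.sum_sub_distrib]
  congr 1
  · congr 1
    · simp [ite_and]
    · rw [Finset.sum_eq_single b, Finset.sum_eq_single a] <;> simp +contextual [Ne.symm, eq_comm]
  · by_cases h : b = a.rev
    · simp only [h, true_and, if_true]
      refine Finset.sum_congr rfl fun e _ => ?_
      rw [Finset.sum_eq_single e.rev] <;> simp +contextual
    · simp [h]

/-- The partial sums of `(q - q⁻¹) q^{-2ρ_e}`, up to a constant. -/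
def rhoPotential (s : ℂˣ) (a : Fin N) : ℂ :=
  (qrho s a)⁻¹ ^ 2 * rdiag s a a.rev + if a.rev < a then qpar s - (qpar s)⁻¹ else 0

/-- Away from the middle ρ drops by 1 at each step and q^{-2ρ-1} is a primitive of (q - q⁻¹)q^{-2ρ}.
In the middle ρ drops by 1/2 twice, or by 0 once; the changes of `rdiag` and of the added constant
in the potential absorb exactly this irregularity. -/
theorem rhoPotential_succ (s : ℂˣ) {k : ℕ} (hk : k + 1 < N) :
    rhoPotential s ⟨k + 1, hk⟩ = rhoPotential s ⟨k, Nat.lt_of_succ_lt hk⟩ +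
      (qpar s - (qpar s)⁻¹) * (qrho s ⟨k, Nat.lt_of_succ_lt hk⟩)⁻¹ ^ 2 := by
  have hs := s.ne_zero
  have step (h : twoRho N ⟨k, Nat.lt_of_succ_lt hk⟩ = twoRho N ⟨k + 1, hk⟩ + 2) :
      qrho s ⟨k, Nat.lt_of_succ_lt hk⟩ = qpar s * qrho s ⟨k + 1, hk⟩ := by
    simp [qrho, h, zpow_add, qpar, mul_comm]
  have hz := qrho_ne_zero s ⟨k + 1, hk⟩
  have hq := qpar_ne_zero s
  rcases lt_trichotomy (2 * (k + 1) + 1) N with h | h | h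
  · have h1 : twoRho N ⟨k, Nat.lt_of_succ_lt hk⟩ = twoRho N ⟨k + 1, hk⟩ + 2 := by
      simp only [twoRho, Fin.lt_def, Fin.ext_iff, Fin.val_rev]
      split_ifs <;> grind
    have := step h1
    have a1 : ¬ (k + 1 = N - (k + 1 + 1)) := by lia
    have a2 : ¬ (k = N - (k + 1)) := by lia
    have a3 : ¬ (N - (k + 1 + 1) < k + 1) := by lia
    have a4 : ¬ (N - (k + 1) < k) := by lia
    simp only [rhoPotential, rdiag, Fin.lt_def, Fin.ext_iff, Fin.val_rev, a1, a2, a3, a4,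
      if_false, if_true, this]
    field_simp
    ring
  · have h0 : qrho s ⟨k + 1, hk⟩ = 1 :=
      qrho_of_eq_rev s (by simp only [Fin.ext_iff, Fin.val_rev]; lia)
    have h1 : twoRho N ⟨k, Nat.lt_of_succ_lt hk⟩ = 1 := by
      simp only [twoRho, Fin.lt_def, Fin.ext_iff, Fin.val_rev]
      split_ifs <;> grind
    have h2 : qrho s ⟨k, Nat.lt_of_succ_lt hk⟩ = s := by simp [qrho, h1]
    have a1 : k + 1 = N - (k + 1 + 1) := by lia
    have a2 : ¬ (k = N - (k + 1)) := by lia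
    have a3 : ¬ (N - (k + 1 + 1) < k + 1) := by lia
    have a4 : ¬ (N - (k + 1) < k) := by lia
    simp only [rhoPotential, rdiag, Fin.lt_def, Fin.ext_iff, Fin.val_rev, ← a1, a2, a4,
      lt_irrefl, if_false, if_true, h0, h2, qpar]
    field_simp
    ring
  · rcases lt_trichotomy (2 * k + 1) N with h' | h' | h'
    · have hN : N = 2 * (k + 1) := by lia
      have h1 : twoRho N ⟨k, Nat.lt_of_succ_lt hk⟩ = 0 := by
        simp only [twoRho, Fin.lt_def, Fin.ext_iff, Fin.val_rev]
        split_ifs <;> grind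
      have h0 : twoRho N ⟨k + 1, hk⟩ = 0 := by
        simp only [twoRho, Fin.lt_def, Fin.ext_iff, Fin.val_rev]
        split_ifs <;> grind
      have a1 : ¬ (k + 1 = N - (k + 1 + 1)) := by lia
      have a2 : ¬ (k = N - (k + 1)) := by lia
      have a3 : N - (k + 1 + 1) < k + 1 := by lia
      have a4 : ¬ (N - (k + 1) < k) := by lia
      simp only [rhoPotential, rdiag, Fin.lt_def, Fin.ext_iff, Fin.val_rev, a1, a2, a3, a4,
        if_false, if_true, qrho, h0, h1, zpow_zero, Units.val_one]
      ring
    · have h0 : qrho s ⟨k, Nat.lt_of_succ_lt hk⟩ = 1 :=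
        qrho_of_eq_rev s (by simp only [Fin.ext_iff, Fin.val_rev]; lia)
      have h1 : twoRho N ⟨k + 1, hk⟩ = -1 := by
        simp only [twoRho, Fin.lt_def, Fin.ext_iff, Fin.val_rev]
        split_ifs <;> grind
      have h2 : qrho s ⟨k + 1, hk⟩ = (s : ℂ)⁻¹ := by simp [qrho, h1]
      have a1 : ¬ (k + 1 = N - (k + 1 + 1)) := by lia
      have a2 : k = N - (k + 1) := by lia
      have a3 : N - (k + 1 + 1) < k + 1 := by lia
      simp only [rhoPotential, rdiag, Fin.lt_def, Fin.ext_iff, Fin.val_rev, ← a2, a1, a3,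
        lt_irrefl, if_false, if_true, h0, h2, qpar]
      field_simp
      ring
    · have h1 : twoRho N ⟨k, Nat.lt_of_succ_lt hk⟩ = twoRho N ⟨k + 1, hk⟩ + 2 := by
        simp only [twoRho, Fin.lt_def, Fin.ext_iff, Fin.val_rev]
        split_ifs <;> grind
      have := step h1
      have a1 : ¬ (k + 1 = N - (k + 1 + 1)) := by lia
      have a2 : ¬ (k = N - (k + 1)) := by lia
      have a3 : N - (k + 1 + 1) < k + 1 := by lia
      have a4 : N - (k + 1) < k := by lia
      simp only [rhoPotential, rdiag, Fin.lt_def, Fin.ext_iff, Fin.val_rev, a1, a2, a3, a4,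
        if_false, if_true, this]
      field_simp
      ring

theorem sum_lt_qrho (s : ℂˣ) (a : Fin N) :
    ∑ e, (if e < a then (qpar s - (qpar s)⁻¹) * (qrho s e)⁻¹ ^ 2 else 0) =
      rhoPotential s a - rhoPotential s ⟨0, a.pos⟩ := by
  obtain ⟨k, hk⟩ := a
  induction k with
  | zero => simp [Fin.lt_def]
  | succ k ih =>
    rw [rhoPotential_succ, add_sub_right_comm, ← ih (Nat.lt_of_succ_lt hk)]
    simp only [Fin.lt_def]
    rw [← Finset.sum_erase_add _ _ (Finset.mem_univ (⟨k, Nat.lt_of_succ_lt hk⟩ : Fin N)),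
      ← Finset.sum_erase_add (a := (⟨k, Nat.lt_of_succ_lt hk⟩ : Fin N)) _ _ (Finset.mem_univ _)]
    simp only [lt_irrefl, Nat.lt_succ_self, if_true, if_false, add_zero]
    congr 1
    refine Finset.sum_congr rfl fun e he => ?_
    have : (e : ℕ) ≠ k := fun h => Finset.ne_of_mem_erase he (Fin.ext h)
    have : (e : ℕ) < k + 1 ↔ (e : ℕ) < k := by lia
    simp only [this]

theorem sum_between_qrho (s : ℂˣ) {a c : Fin N} (h : c < a) :
    ∑ e, (if e < a then if c < e then (qpar s - (qpar s)⁻¹) * (qrho s e)⁻¹ ^ 2 else 0 else 0) =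
      rhoPotential s a - rhoPotential s c - (qpar s - (qpar s)⁻¹) * (qrho s c)⁻¹ ^ 2 := by
  have h1 := sum_lt_qrho s a
  have h2 := sum_lt_qrho s c
  have h3 : ∑ e, (if e = c then (qpar s - (qpar s)⁻¹) * (qrho s e)⁻¹ ^ 2 else 0) =
    (qpar s - (qpar s)⁻¹) * (qrho s c)⁻¹ ^ 2 := by simp
  have h4 : rhoPotential s a - rhoPotential s c =
      (rhoPotential s a - rhoPotential s ⟨0, a.pos⟩) -
        (rhoPotential s c - rhoPotential s ⟨0, c.pos⟩) := by ring
  rw [h4, ← h1, ← h2, ← h3, ← Finset.sum_sub_distrib, ← Finset.sum_sub_distrib]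
  refine Finset.sum_congr rfl fun e _ => ?_
  rcases lt_trichotomy e c with h' | h' | h'
  · simp [h', h'.trans h, h'.not_gt, h'.ne]
  · subst h'; simp [h]
  · simp [h', h'.not_gt, h'.ne']

theorem rdiag_inv (s : ℂˣ) (a b : Fin N) : rdiag s⁻¹ a b = (rdiag s a b)⁻¹ := by
  unfold rdiag
  split_ifs <;> simp [qpar_inv]

theorem rdiag_ne_zero (s : ℂˣ) (a b : Fin N) : rdiag s a b ≠ 0 := by
  unfold rdiag
  split_ifs <;> simp [qpar_ne_zero]

theorem rdiag_rev_inv (s : ℂˣ) (a : Fin N) : (rdiag s a a.rev)⁻¹ = rdiag s a a.rev +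
    if a = a.rev then 0 else qpar s - (qpar s)⁻¹ := by
  by_cases h : a = a.rev
  · simp [rdiag, ← h]
  · simp [rdiag, h]

/-- Off the pairs (a, a') the metric part is absent and R acts on the span of (a, b) and (b, a) by a
unipotent triangular 2×2 block, or by the scalar q if a = b. Replacing q by q⁻¹ changes the sign of
q - q⁻¹ and so inverts it. -/
theorem sum_Rmat_mul_Rmat_inv_of_ne (s : ℂˣ) {a b : Fin N} (h : b ≠ a.rev) (c d : Fin N) :
    ∑ e, ∑ f, Rmat s N a b e f * Rmat s⁻¹ N e f c d = if a = c ∧ b = d then 1 else 0 := by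
  have h' : a ≠ b.rev := fun h' => h (by simp [h'])
  rw [sum_Rmat]
  simp only [Rmat_eq, h, h', false_and, if_false, sub_zero, rdiag_inv, qpar_inv, inv_inv]
  have hr := rdiag_ne_zero s a b
  rcases lt_trichotomy a b with h1 | h1 | h1
  · by_cases h2 : a = c ∧ b = d
    · obtain ⟨rfl, rfl⟩ := h2
      simp [h1.not_gt, hr]
    · simp [h1.not_gt, h2]
  · subst h1
    by_cases h2 : a = c ∧ a = d
    · obtain ⟨rfl, h2⟩ := h2
      simp [← h2, hr]
    · simp [h2]
  · have h3 : rdiag s a b = 1 := by simp [rdiag, h1.ne', h]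
    have h3' : rdiag s b a = 1 := by simp [rdiag, h1.ne, h']
    by_cases h2 : a = c ∧ b = d
    · obtain ⟨rfl, rfl⟩ := h2
      simp [h1, h1.not_gt, h1.ne', h3]
    · by_cases h4 : a = d ∧ b = c
      · obtain ⟨rfl, rfl⟩ := h4
        simp [h1, h1.ne', h3, h3', h1.not_gt]
      · have : ¬ (b = c ∧ a = d) := fun h => h4 h.symm
        simp only [h1, h1.not_gt, h2, this, and_false, and_true, if_false, if_true, h4, add_zero,
          mul_zero]

theorem Rmat_inv_rev (s : ℂˣ) (c e : Fin N) : Rmat s⁻¹ N e e.rev c c.rev =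
    (if e = c then (rdiag s c c.rev)⁻¹ else 0)
    - (if e = c.rev then if c < e then qpar s - (qpar s)⁻¹ else 0 else 0)
    + (if c < e then (qpar s - (qpar s)⁻¹) * ((qrho s e)⁻¹ * qrho s c) else 0) := by
  have h1 : (e = c.rev ∧ e.rev = c ∧ e.rev < e) ↔ e = c.rev ∧ c < e :=
    ⟨fun ⟨h, h', h''⟩ => ⟨h, h' ▸ h''⟩, fun ⟨h, h'⟩ => ⟨h, by simp [h], by simpa [h] using h'⟩⟩
  have h2 : (e = c ∧ e.rev = c.rev) ↔ e = c := by simp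
  simp only [Rmat_eq, h1, h2, true_and, ite_and, rdiag_inv, qrho_inv, qpar_inv,
    inv_inv]
  rw [add_sub_assoc, sub_eq_add_neg (ite _ (ite _ _ _) _), sub_eq_add_neg (ite _ _ _), add_assoc]
  congr 1
  · split_ifs with h <;> simp [h]
  · split_ifs <;> ring

theorem rdiag_rev_comm (s : ℂˣ) (a : Fin N) : rdiag s a.rev a = rdiag s a a.rev := by
  simp [rdiag, eq_comm]

/-- This is the one entry of R(q) R(q⁻¹) where cancellation is not immediate: the product of the two
metric parts sums over all indices between c and a, and telescopes through `rhoPotential`. -/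
theorem sum_Rmat_mul_Rmat_inv_rev_lt (s : ℂˣ) {a c : Fin N} (h : c < a) :
    ∑ e, ∑ f, Rmat s N a a.rev e f * Rmat s⁻¹ N e f c c.rev = 0 := by
  have hza := qrho_ne_zero s a
  have hzc := qrho_ne_zero s c
  -- Three kinds of e contribute: e = c meets the diagonal of the inverse, e = c' meets its flip
  -- part, and every e strictly between c and a meets its metric part.
  have hsum : ∑ e, (if e < a then (qpar s - (qpar s)⁻¹) * (qrho s a * (qrho s e)⁻¹) *
        Rmat s⁻¹ N e e.rev c c.rev else 0) =
      (qpar s - (qpar s)⁻¹) * (qrho s a * (qrho s c)⁻¹) * (rdiag s c c.rev)⁻¹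
      - (if c.rev < a then if c < c.rev then
          (qpar s - (qpar s)⁻¹) ^ 2 * (qrho s a * qrho s c) else 0 else 0)
      + (qpar s - (qpar s)⁻¹) * (qrho s a * qrho s c) *
        (rhoPotential s a - rhoPotential s c - (qpar s - (qpar s)⁻¹) * (qrho s c)⁻¹ ^ 2) := by
    have g1 : (qpar s - (qpar s)⁻¹) * (qrho s a * (qrho s c)⁻¹) * (rdiag s c c.rev)⁻¹ =
        ∑ e, if e = c then
          (qpar s - (qpar s)⁻¹) * (qrho s a * (qrho s c)⁻¹) * (rdiag s c c.rev)⁻¹ else 0 := by simp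
    have g2 : (if c.rev < a then if c < c.rev then
          (qpar s - (qpar s)⁻¹) ^ 2 * (qrho s a * qrho s c) else 0 else 0) =
        ∑ e, if e = c.rev then (if c.rev < a then if c < c.rev then
          (qpar s - (qpar s)⁻¹) ^ 2 * (qrho s a * qrho s c) else 0 else 0) else 0 := by simp
    rw [← sum_between_qrho s h, g1, g2, Finset.mul_sum, ← Finset.sum_sub_distrib,
      ← Finset.sum_add_distrib]
    refine Finset.sum_congr rfl fun e _ => ?_
    rw [Rmat_inv_rev]
    by_cases h1 : e = c
    · subst h1
      by_cases h2 : e = e.rev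
      · simp [h, ← h2]
      · simp [h, h2]
    · by_cases h2 : e = c.rev
      · subst h2
        rw [qrho_rev]
        split_ifs <;> first | contradiction | (field_simp; ring)
      · simp only [h1, h2, if_false]
        split_ifs <;> ring
  rw [sum_Rmat, hsum, Rmat_inv_rev]
  have hrc := rdiag_rev_inv s c
  have key := Rmat_inv_rev s c a.rev
  rw [Fin.rev_rev] at key
  rw [key]
  simp only [rhoPotential, qrho_rev, inv_inv, if_true, h, h.ne', if_false, zero_sub]
  have hrot : a.rev < c ↔ c.rev < a := by
    rw [← Fin.rev_lt_rev, Fin.rev_rev]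
  have hrc0 := rdiag_ne_zero s c c.rev
  have hq := qpar_ne_zero s
  have hne : a.rev ≠ c.rev := by simpa using h.ne'
  -- What remains is a polynomial identity in q and the powers q^ρ for each relative position of c,
  -- c', a and a'. When a' = c, the flip part of the first factor meets the diagonal of the second.
  rcases lt_or_ge c c.rev with h1 | h1
  · rw [if_neg h1.ne] at hrc
    rcases lt_trichotomy c a.rev with h2 | h2 | h2
    · have h3 : ¬ c.rev < a := fun h3 => h2.not_gt (hrot.2 h3)
      have h4 : a ≠ c.rev := fun h4 => h2.ne (by simp [h4])
      simp only [h1, h1.not_gt, h2, h2.ne', h3, h4, if_true, if_false, hrc, hne]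
      split_ifs <;> field_simp <;> ring
    · have h3 : a = c.rev := by simp [h2]
      subst h3
      simp only [Fin.rev_rev, h1, h1.ne, h1.not_gt, lt_irrefl, if_true, if_false, rdiag_rev_comm,
        hrc, qrho_rev, inv_inv]
      field_simp
      ring
    · have h3 : c.rev < a := hrot.1 h2
      have h4 : a ≠ c.rev := h3.ne'
      have h5 : a.rev < a := h2.trans h
      simp only [h1, h1.not_gt, h2.ne, h2.not_gt, h3, h4, h5, if_true, if_false, hrc, hne]
      field_simp
      ring
  · have h2 : c.rev < a := h1.trans_lt h
    have h3 : a.rev < c := hrot.2 h2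
    have h4 : a.rev < a := h3.trans h
    simp only [h1.not_gt, h2, h3.ne, h3.not_gt, h2.ne', h4, if_true, if_false, hrc, hne]
    rcases h1.lt_or_eq with h5 | h5
    · simp only [h5, h5.ne', if_true, if_false]
      field_simp
      ring
    · have h6 := qrho_of_eq_rev s h5.symm
      have h7 : rdiag s c c = 1 := by simp [rdiag, h5]
      simp only [h5, lt_irrefl, if_false, if_true, h6, h7]
      field_simp
      ring

/-- The pairs (a, a') are not mixed with the others, and among them R is triangular for the order of
a. Hence a < c gives zero term by term, a = c gives the product of inverse diagonal entries, and
only a > c needs the telescoping sum. -/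
theorem sum_Rmat_mul_Rmat_inv (s : ℂˣ) (a b c d : Fin N) :
    ∑ e, ∑ f, Rmat s N a b e f * Rmat s⁻¹ N e f c d = if a = c ∧ b = d then 1 else 0 := by
  by_cases hb : b = a.rev
  · subst hb
    by_cases hd : d = c.rev
    · subst hd
      rcases lt_trichotomy a c with h | h | h
      · have h1 (e : Fin N) (he : e < a) : Rmat s⁻¹ N e e.rev c c.rev =
            if e = c.rev then if c < e then -(qpar s - (qpar s)⁻¹) else 0 else 0 := by
          rw [Rmat_inv_rev]
          have := he.trans h
          simp only [this.ne, this.not_gt, if_false]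
          simp
        have key := Rmat_inv_rev s c a.rev
        rw [Fin.rev_rev] at key
        rw [sum_Rmat, key, Rmat_inv_rev, Finset.sum_eq_zero]
        · have h2 : a.rev ≠ c.rev := by simpa using h.ne
          have h3 (h' : a.rev < a) : ¬ c < a.rev := (h'.trans h).not_gt
          have h4 (h' : a.rev < a) : a.rev ≠ c := (h'.trans h).ne
          by_cases h5 : a.rev < a
          · simp [h.ne, h.not_gt, h2, h3 h5, h4 h5]
          · simp [h.ne, h.not_gt, h5]
        · intro e _
          split_ifs with he
          · rw [h1 e he]
            simp [(he.trans h).not_gt]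
          · rfl
      · subst h
        have key := Rmat_inv_rev s a a.rev
        rw [Fin.rev_rev] at key
        rw [sum_Rmat, key, Rmat_inv_rev, Finset.sum_eq_zero]
        · have hr := rdiag_ne_zero s a a.rev
          by_cases h : a.rev < a
          · simp [h, h.ne, h.not_gt, hr]
          · simp [h, hr]
        · intro e _
          split_ifs with he
          · rw [Rmat_inv_rev]
            simp [he.not_gt, he.ne]
          · rfl
      · rw [sum_Rmat_mul_Rmat_inv_rev_lt s h, if_neg fun h' => h.ne' h'.1]
    · have h1 (e : Fin N) : Rmat s⁻¹ N e e.rev c d = 0 := by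
        have h2 : ¬ (e = c ∧ e.rev = d) := by rintro ⟨rfl, rfl⟩; exact hd rfl
        have h3 : ¬ (e = d ∧ e.rev = c ∧ e.rev < e) := by rintro ⟨rfl, rfl, _⟩; simp at hd
        simp only [Rmat_eq, h2, h3, hd, if_false, false_and, and_false]
        simp
      have h2 := h1 a.rev
      rw [Fin.rev_rev] at h2
      have h3 : ¬ (a = c ∧ a.rev = d) := by rintro ⟨rfl, rfl⟩; exact hd rfl
      rw [sum_Rmat]
      simp [h1, h2, h3]
  · exact sum_Rmat_mul_Rmat_inv_of_ne s hb c d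

theorem RmatB_mul_RmatB_inv (s : ℂˣ) (N : ℕ) (B : Type*) [Ring B] [Algebra ℂ B] :
    RmatB s N B * RmatB s⁻¹ N B = 1 := by
  ext ⟨a, b⟩ ⟨c, d⟩
  simp only [RmatB, Matrix.mul_apply, Fintype.sum_prod_type, ← map_mul, ← map_sum,
    sum_Rmat_mul_Rmat_inv, Matrix.one_apply, Prod.mk.injEq]
  split_ifs <;> simp

theorem RmatB_inv_mul_RmatB (s : ℂˣ) (N : ℕ) (B : Type*) [Ring B] [Algebra ℂ B] :
    RmatB s⁻¹ N B * RmatB s N B = 1 := by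
  simpa using RmatB_mul_RmatB_inv s⁻¹ N B

/-! ### Complex conjugation of the structure constants for |s| = 1 -/

theorem conj_unit {s : ℂˣ} (hs : ‖(s : ℂ)‖ = 1) : starRingEnd ℂ (s : ℂ) = ((s⁻¹ : ℂˣ) : ℂ) := by
  rw [Units.val_inv_eq_inv_val, Complex.inv_eq_conj hs]

theorem conj_zpow {s : ℂˣ} (hs : ‖(s : ℂ)‖ = 1) (k : ℤ) :
    starRingEnd ℂ ((s ^ k : ℂˣ) : ℂ) = ((s⁻¹ ^ k : ℂˣ) : ℂ) := by
  rw [Units.val_zpow_eq_zpow_val, map_zpow₀, conj_unit hs, Units.val_zpow_eq_zpow_val]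

theorem conj_qpar {s : ℂˣ} (hs : ‖(s : ℂ)‖ = 1) : starRingEnd ℂ (qpar s) = (qpar s)⁻¹ := by
  rw [← qpar_inv, qpar, map_pow, conj_unit hs, qpar]

/-- The entries are Laurent polynomials in s with integer coefficients, and conjugation sends s to
s⁻¹. With the inversion formula, the conjugate of R is thus R⁻¹. -/
theorem conj_Rmat {s : ℂˣ} (hs : ‖(s : ℂ)‖ = 1) (a b c d : Fin N) :
    starRingEnd ℂ (Rmat s N a b c d) = Rmat s⁻¹ N a b c d := by
  simp only [Rmat, map_add, map_sub, apply_ite (starRingEnd ℂ), map_mul, map_zero, map_one,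
    conj_zpow hs, conj_qpar hs, map_inv₀, qpar_inv]

/-- Hermiticity comes from ρ_{a'} = -ρ_a. It offsets the exchange of the two factors in the
orthogonality relations when products are reversed. -/
theorem conj_metric {s : ℂˣ} (hs : ‖(s : ℂ)‖ = 1) (a b : Fin N) :
    starRingEnd ℂ (metric s N a b) = metric s N b a := by
  by_cases h : b = a.rev
  · subst h
    simp only [metric, Fin.rev_rev, if_true, conj_zpow hs, twoRho_rev]
    simp
  · have h' : a ≠ b.rev := fun h' => h (by simp [h'])
    simp [metric, h, h']

end Inverse

/-! ### The conjugation `T^× = T` -/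

/-- The opposite of a complex algebra, with the conjugate action of the scalars. -/
def ConjOp (A : Type*) : Type _ := Aᵐᵒᵖ

section ConjOp

set_option linter.unusedSectionVars false

variable {A : Type*} [Ring A] [Algebra ℂ A]

instance : Ring (ConjOp A) := inferInstanceAs (Ring Aᵐᵒᵖ)

/-- With this scalar action an antilinear antimultiplicative map into A is an ordinary algebra map
into `ConjOp A`, so that `SOq.lift` can construct star structures. -/
instance : Algebra ℂ (ConjOp A) :=
  RingHom.toAlgebra' (S := ConjOp A)
    ((algebraMap ℂ Aᵐᵒᵖ).comp (starRingEnd ℂ) : ℂ →+* Aᵐᵒᵖ)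
    fun c (x : Aᵐᵒᵖ) => Algebra.commutes (starRingEnd ℂ c) x

/-- The underlying additive isomorphism from `ConjOp A` to `A`. -/
def ConjOp.unop : ConjOp A ≃+ A := (MulOpposite.opAddEquiv (α := A)).symm

theorem ConjOp.unop_mul (x y : ConjOp A) : (x * y).unop = y.unop * x.unop := rfl

theorem ConjOp.unop_one : (1 : ConjOp A).unop = 1 := rfl

theorem ConjOp.unop_algebraMap (c : ℂ) :
    (algebraMap ℂ (ConjOp A) c).unop = algebraMap ℂ A (starRingEnd ℂ c) := rfl

theorem ConjOp.unop_smul (c : ℂ) (x : ConjOp A) : (c • x).unop = starRingEnd ℂ c • x.unop := by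
  rw [Algebra.smul_def, ConjOp.unop_mul, ConjOp.unop_algebraMap, ← Algebra.commutes,
    ← Algebra.smul_def]

theorem ConjOp.unop_list_prod (l : List (ConjOp A)) :
    l.prod.unop = (l.map ConjOp.unop).reverse.prod := by
  induction l with
  | nil => rfl
  | cons x l ih => simp [ConjOp.unop_mul, ih]

end ConjOp

/-! ### Reversal and conjugation of the defining relations -/

section Cross

variable {s : ℂˣ} {N : ℕ}

theorem sum_comm_pairs {ι M : Type*} [Fintype ι] [AddCommMonoid M] (F : ι → ι → ι → ι → M) :
    ∑ c, ∑ d, ∑ e, ∑ f, F c d e f = ∑ e, ∑ f, ∑ c, ∑ d, F c d e f := by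
  calc _ = ∑ p : ι × ι, ∑ r : ι × ι, F p.1 p.2 r.1 r.2 := by simp only [Fintype.sum_prod_type]
    _ = ∑ r : ι × ι, ∑ p : ι × ι, F p.1 p.2 r.1 r.2 := Finset.sum_comm
    _ = _ := by simp only [Fintype.sum_prod_type]

theorem sum_Rmat_mul_sum_Rmat_inv (s : ℂˣ) (a b : Fin N) (v : Fin N → Fin N → ℂ) :
    ∑ c, ∑ d, Rmat s N a b c d * ∑ e, ∑ f, Rmat s⁻¹ N c d e f * v e f = v a b := by
  calc _ = ∑ c, ∑ d, ∑ e, ∑ f, Rmat s N a b c d * Rmat s⁻¹ N c d e f * v e f := by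
        simp only [Finset.mul_sum, mul_assoc]
    _ = ∑ e, ∑ f, (∑ c, ∑ d, Rmat s N a b c d * Rmat s⁻¹ N c d e f) * v e f := by
        rw [sum_comm_pairs]
        simp only [Finset.sum_mul]
    _ = _ := by
        simp only [sum_Rmat_mul_Rmat_inv, ite_and, ite_mul, zero_mul, one_mul]
        simp

theorem reverse_ofFn {α : Type*} {n : ℕ} (f : Fin n → α) :
    (List.ofFn f).reverse = List.ofFn fun k => f k.rev := by
  apply List.ext_getElem
  · simp
  · intro i h1 h2
    simp only [List.getElem_reverse, List.getElem_ofFn, List.length_ofFn]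
    congr 1
    ext
    simp only [Fin.val_rev]
    lia

theorem unop_tens {A : Type*} [Ring A] [Algebra ℂ A] {K : ℕ}
    (t : Matrix (Fin N) (Fin N) (ConjOp A)) (i j : Fin K → Fin N) :
    (tens t i j).unop =
      tens (t.map ConjOp.unop) (fun k => i k.rev) (fun k => j k.rev) := by
  simp [tens, ConjOp.unop_list_prod, List.map_ofFn, reverse_ofFn, Function.comp_def]

/-- The reversed complex conjugate of a quantum epsilon tensor is a quantum epsilon tensor. -/
theorem IsQEpsilon.conj_rev (hs : ‖(s : ℂ)‖ = 1) {ε : (Fin N → Fin N) → ℂ}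
    (hε : IsQEpsilon s N ε) :
    IsQEpsilon s N fun i => starRingEnd ℂ (ε fun k => i k.rev) := by
  -- Reversing positions carries the adjacent slots k, k + 1 to N - 1 - k, N - 2 - k. They stay
  -- adjacent but in the opposite order, so c and d change places.
  have upd (i : Fin N → Fin N) (k : ℕ) (hk : k + 1 < N) (c d : Fin N) :
      (fun m : Fin N => Function.update (Function.update i ⟨k, Nat.lt_of_succ_lt hk⟩ c)
        ⟨k + 1, hk⟩ d m.rev) =
      Function.update (Function.update (fun m : Fin N => i m.rev) ⟨N - 2 - k, by lia⟩ d)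
        ⟨N - 2 - k + 1, by lia⟩ c := by
    funext m
    have h1 : m.rev = ⟨k + 1, hk⟩ ↔ m = ⟨N - 2 - k, by lia⟩ := by
      simp only [Fin.ext_iff, Fin.val_rev]; lia
    have h2 : m.rev = ⟨k, Nat.lt_of_succ_lt hk⟩ ↔ m = ⟨N - 2 - k + 1, by lia⟩ := by
      simp only [Fin.ext_iff, Fin.val_rev]; lia
    have h3 : m = ⟨N - 2 - k, by lia⟩ → m ≠ ⟨N - 2 - k + 1, by lia⟩ := by
      simp only [Fin.ext_iff, ne_eq]; lia
    simp only [Function.update_apply, h1, h2]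
    split_ifs with h4 h5 <;> first | rfl | exact absurd h5 (h3 h4)
  constructor
  · intro k hk i
    simp only [upd]
    set V : Fin N → Fin N → ℂ := fun c d => starRingEnd ℂ (ε (Function.update
      (Function.update (fun m : Fin N => i m.rev) ⟨N - 2 - k, by lia⟩ c) ⟨N - 2 - k + 1, by lia⟩ d)) with hV
    have hVi : starRingEnd ℂ (ε fun m : Fin N => i m.rev) =
        V (i ⟨k + 1, hk⟩) (i ⟨k, Nat.lt_of_succ_lt hk⟩) := by
      change _ = starRingEnd ℂ (ε _)
      rw [← upd i k hk]
      simp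
    -- Conjugating the eigenvalue equation at the reflected slots replaces R by its inverse and -q⁻¹
    -- by -q.
    have key (a b : Fin N) : ∑ c, ∑ d, Rmat s⁻¹ N b a c d * V c d = -qpar s * V a b := by
      have := congrArg (starRingEnd ℂ) (hε.antisymm (N - 2 - k) (by lia) (Function.update
        (Function.update (fun m : Fin N => i m.rev) ⟨N - 2 - k, by lia⟩ a) ⟨N - 2 - k + 1, by lia⟩ b))
      have hne : (⟨N - 2 - k, by lia⟩ : Fin N) ≠ ⟨N - 2 - k + 1, by lia⟩ := by
        simp [Fin.ext_iff]
      have upd' (c d : Fin N) : Function.update (Function.update (Function.update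
        (Function.update (fun m : Fin N => i m.rev) ⟨N - 2 - k, by lia⟩ a) ⟨N - 2 - k + 1, by lia⟩ b)
          ⟨N - 2 - k, by lia⟩ c) ⟨N - 2 - k + 1, by lia⟩ d = Function.update
        (Function.update (fun m : Fin N => i m.rev) ⟨N - 2 - k, by lia⟩ c) ⟨N - 2 - k + 1, by lia⟩ d := by
        funext m
        simp only [Function.update_apply]
        split_ifs <;> rfl
      simp only [upd', Function.update_self, Function.update_of_ne hne, map_sum, map_mul,
        conj_Rmat hs, map_neg, map_inv₀, conj_qpar hs, inv_inv] at this
      exact this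
    change ∑ c, ∑ d, Rmat s N _ _ c d * V d c = _
    -- Inserting R R⁻¹ = 1 and evaluating R⁻¹ by `key` restores an eigenvalue equation for R, with
    -- eigenvalue the inverse of -q.
    rw [hVi, ← sum_Rmat_mul_sum_Rmat_inv s (i ⟨k + 1, hk⟩) (i ⟨k, Nat.lt_of_succ_lt hk⟩) V]
    simp only [key, Finset.mul_sum]
    refine Finset.sum_congr rfl fun c _ => Finset.sum_congr rfl fun d _ => ?_
    have hq := qpar_ne_zero s
    field_simp
  · intro k hk i
    simp only [upd]
    have := congrArg (starRingEnd ℂ) (hε.traceless (N - 2 - k) (by lia) fun m : Fin N => i m.rev)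
    simp only [map_sum, map_mul, conj_metric hs, map_zero] at this
    rw [Finset.sum_comm]
    exact this

/-- In the conjugate opposite algebra the RTT relation reads R⁻¹ T₂T₁ = T₁T₂ R⁻¹, which is the
original one multiplied by R⁻¹ on both sides. The determinant relation for ε becomes the original
one for the reversed conjugate of ε. -/
theorem isQOrth_conj (hs : ‖(s : ℂ)‖ = 1) :
    IsQOrth s ((T s N).map (ConjOp.unop (A := SOq s N)).symm) where
  rtt a b c d := by
    apply ConjOp.unop.injective
    have h := (rtt_iff (T s N)).1 (isQOrth_T s N).rtt
    have h' : RmatB s⁻¹ N (SOq s N) * (leg2 (T s N) * leg1 (T s N)) =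
        leg1 (T s N) * leg2 (T s N) * RmatB s⁻¹ N (SOq s N) := by
      calc _ = RmatB s⁻¹ N (SOq s N) * (leg2 (T s N) * leg1 (T s N) * RmatB s N (SOq s N)) *
              RmatB s⁻¹ N (SOq s N) := by
            rw [mul_assoc _ _ (RmatB s⁻¹ N (SOq s N)), mul_assoc _ (RmatB s N (SOq s N)),
              RmatB_mul_RmatB_inv, mul_one]
        _ = _ := by
            rw [← h, ← mul_assoc, RmatB_inv_mul_RmatB, one_mul]
    have := congrFun (congrFun h' (a, b)) (c, d)
    rw [Matrix.mul_apply, Matrix.mul_apply, Fintype.sum_prod_type, Fintype.sum_prod_type] at this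
    simp only [leg1_mul_leg2, leg2_mul_leg1, RmatB, ← Algebra.commutes, ← Algebra.smul_def] at this
    simpa [ConjOp.unop_smul, ConjOp.unop_mul, conj_Rmat hs] using this
  orth₁ a d := by
    apply ConjOp.unop.injective
    have := (isQOrth_T s N).orth₁ d a
    rw [Finset.sum_comm] at this
    simpa [ConjOp.unop_smul, ConjOp.unop_mul, conj_metric hs, ConjOp.unop_one] using this
  orth₂ b d := by
    apply ConjOp.unop.injective
    have := (isQOrth_T s N).orth₂ d b
    rw [Finset.sum_comm] at this
    simpa [ConjOp.unop_smul, ConjOp.unop_mul, conj_metric hs, ConjOp.unop_one] using this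
  det ε hε i := by
    apply ConjOp.unop.injective
    have h := (isQOrth_T s N).det _ (hε.conj_rev hs) fun k => i k.rev
    have hT : ((T s N).map (ConjOp.unop (A := SOq s N)).symm).map ConjOp.unop = T s N := by
      ext; simp
    simp only [Fin.rev_rev] at h
    -- Reversing the summation multi-index matches the reversal of the factors of `tens`.
    rw [← (Equiv.arrowCongr Fin.revPerm (Equiv.refl (Fin N))).sum_comp] at h
    simp only [map_sum, ConjOp.unop_smul, unop_tens, hT, ConjOp.unop_one]
    refine Eq.trans (Finset.sum_congr rfl fun j _ => ?_) h
    simp [Equiv.arrowCongr, Function.comp_def]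

/-- The conjugation `T^× = T` as an algebra map to the conjugate opposite algebra. -/
def crossHom (hs : ‖(s : ℂ)‖ = 1) : SOq s N →ₐ[ℂ] ConjOp (SOq s N) := SOq.lift (isQOrth_conj hs)

/-- The conjugation `T^× = T` as an antilinear map. -/
def crossLin (hs : ‖(s : ℂ)‖ = 1) : SOq s N →ₛₗ[starRingEnd ℂ] SOq s N where
  toFun x := (crossHom hs x).unop
  map_add' x y := by simp
  map_smul' c x := by simp [ConjOp.unop_smul]

theorem crossLin_T (hs : ‖(s : ℂ)‖ = 1) (a b : Fin N) : crossLin hs (T s N a b) = T s N a b := by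
  simp [crossLin, crossHom]

theorem crossLin_mul (hs : ‖(s : ℂ)‖ = 1) (x y : SOq s N) :
    crossLin hs (x * y) = crossLin hs y * crossLin hs x := by
  simp [crossLin, ConjOp.unop_mul]

theorem crossLin_algebraMap (hs : ‖(s : ℂ)‖ = 1) (c : ℂ) :
    crossLin hs (algebraMap ℂ (SOq s N) c) = algebraMap ℂ _ (starRingEnd ℂ c) := by
  simp [crossLin, ConjOp.unop_algebraMap]

theorem map_antimul {A : Type*} [Ring A] [Algebra ℂ A] (f : A →ₛₗ[starRingEnd ℂ] A)
    (hf : ∀ x y, f (x * y) = f y * f x) (z w : A ⊗[ℂ] A) :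
    TensorProduct.map f f (z * w) = TensorProduct.map f f w * TensorProduct.map f f z := by
  induction z using TensorProduct.induction_on with
  | zero => simp
  | add z z' h h' => simp only [add_mul, mul_add, map_add, h, h']
  | tmul a b =>
    induction w using TensorProduct.induction_on with
    | zero => simp
    | add w w' h h' => simp only [add_mul, mul_add, map_add, h, h']
    | tmul c d => simp [hf]

/-- The star structure `×`, with `T^× = T`. -/
def cross (N : ℕ) (hs : ‖(s : ℂ)‖ = 1) : HopfStar (SOq s N) where
  toMap := crossLin hs
  antimul := crossLin_mul hs
  comul_star x := by
    induction x using SOq.induction with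
    | alg r =>
      rw [crossLin_algebraMap]
      simp only [Algebra.algebraMap_eq_smul_one, map_smul, map_smulₛₗ, Bialgebra.comul_one,
        Algebra.TensorProduct.one_def, TensorProduct.map_tmul]
      have := crossLin_algebraMap (N := N) hs 1
      simp only [map_one] at this
      rw [this]
    | gen a b => simp [crossLin_T, comul_T]
    | add x y hx hy => simp only [map_add, hx, hy]
    | mul x y hx hy =>
      rw [crossLin_mul, Bialgebra.comul_mul, hx, hy, Bialgebra.comul_mul,
        map_antimul _ (crossLin_mul hs)]
  counit_star x := by
    induction x using SOq.induction with
    | alg r => simp [crossLin_algebraMap]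
    | gen a b => simp [crossLin_T, counit_T, apply_ite]
    | add x y hx hy => simp only [map_add, hx, hy]
    | mul x y hx hy => simp [crossLin_mul, hx, hy, mul_comm]
  invol x := by
    induction x using SOq.induction with
    | alg r => simp [crossLin_algebraMap]
    | gen a b => simp [crossLin_T]
    | add x y hx hy => simp only [map_add, hx, hy]
    | mul x y hx hy => simp only [crossLin_mul, hx, hy]

theorem cross_T (hs : ‖(s : ℂ)‖ = 1) (a b : Fin N) : cross N hs (T s N a b) = T s N a b :=
  crossLin_T hs a b

end Cross

/-! ### Automorphisms `T ↦ E T E⁻¹` for monomial matrices `E` -/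

section Monomial

variable {s : ℂˣ} {N : ℕ}

/-- R conserves weight: a nonzero entry has either the same indices above and below, or a pair a, a'
above and a pair c, c' below, and each such pair has total weight 1. So diagonal E with e_a e_{a'} =
1 satisfy that E ⊗ E commutes with R. -/
theorem Rmat_mul_weights {e : Fin N → ℂ} (he : ∀ a, e a * e a.rev = 1) (a b c d : Fin N) :
    Rmat s N a b c d * (e c * e d) = Rmat s N a b c d * (e a * e b) := by
  simp only [Rmat, add_mul, sub_mul, ite_mul, zero_mul]
  congr 1
  · congr 1
    · split_ifs with h
      · rw [h.1, h.2]
      all_goals first | rfl | rw [h.1, h.2]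
    · split_ifs with h
      · rw [h.1, h.2.1, mul_comm (e d)]
      · rfl
  · split_ifs with h
    · rw [h.1, h.2.1, he, he]
    · rfl

theorem metric_mul_weights {e : Fin N → ℂ} (he : ∀ a, e a * e a.rev = 1) (a b : Fin N) :
    metric s N a b * (e a * e b) = metric s N a b := by
  by_cases h : b = a.rev
  · rw [h, he, mul_one]
  · simp [metric, h]

theorem inv_weights {e : Fin N → ℂ} (he : ∀ a, e a * e a.rev = 1) (a : Fin N) :
    (e a)⁻¹ * (e a.rev)⁻¹ = 1 := by
  rw [← mul_inv, he, inv_one]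

theorem weight_ne_zero {e : Fin N → ℂ} (he : ∀ a, e a * e a.rev = 1) (a : Fin N) : e a ≠ 0 :=
  left_ne_zero_of_mul_eq_one (he a)

/-- The permutation `π` and the weights `e` define a symmetry of the R-matrix and the metric, given
by the monomial matrix with the entries `e_a` at the places `(a, π(a))`. -/
structure IsMonomialSymm (s : ℂˣ) (π : Equiv.Perm (Fin N)) (e : Fin N → ℂ) : Prop where
  rev : ∀ a, π a.rev = (π a).rev
  rho : ∀ a, twoRho N (π a) = twoRho N a
  rmat : ∀ a b c d, Rmat s N (π a) (π b) (π c) (π d) = Rmat s N a b c d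
  weights : ∀ a, e a * e a.rev = 1

/-- The monomial matrix with the entries `e_a` at the places `(a, π(a))`. -/
def monomialMatrix (π : Equiv.Perm (Fin N)) (e : Fin N → ℂ) : Matrix (Fin N) (Fin N) ℂ :=
  fun a b => if b = π a then e a else 0

/-- The conjugate `E t E⁻¹` of a matrix by a monomial matrix. -/
def monomialConj {B : Type*} [Ring B] [Algebra ℂ B] (π : Equiv.Perm (Fin N)) (e : Fin N → ℂ)
    (t : Matrix (Fin N) (Fin N) B) : Matrix (Fin N) (Fin N) B :=
  fun a b => (e a * (e b)⁻¹) • t (π a) (π b)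

variable {π : Equiv.Perm (Fin N)} {e : Fin N → ℂ}

theorem monomialMatrix_inv (he : ∀ a, e a ≠ 0) :
    (monomialMatrix π e)⁻¹ = Matrix.of fun a b => if a = π b then (e b)⁻¹ else 0 := by
  apply Matrix.inv_eq_right_inv
  ext a b
  rw [Matrix.mul_apply, Finset.sum_eq_single (π a)]
  · by_cases h : a = b
    · subst h; simp [monomialMatrix, he]
    · simp [monomialMatrix, h]
  · intro c _ hc; simp [monomialMatrix, hc]
  · simp

theorem sum_monomialMatrix (he : ∀ a, e a ≠ 0) {B : Type*} [Ring B] [Algebra ℂ B]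
    (t : Matrix (Fin N) (Fin N) B) (a b : Fin N) :
    ∑ c, ∑ d, (monomialMatrix π e a c * (monomialMatrix π e)⁻¹ d b) • t c d =
      monomialConj π e t a b := by
  simp only [monomialMatrix_inv he, Matrix.of_apply]
  rw [Finset.sum_eq_single (π a), Finset.sum_eq_single (π b)]
  · simp [monomialMatrix, monomialConj]
  · intro c _ hc; simp [hc]
  · simp
  · intro c _ hc; simp [monomialMatrix, hc]
  · simp

theorem sum_perm_pair {M : Type*} [AddCommMonoid M] (π : Equiv.Perm (Fin N))
    (F : Fin N → Fin N → M) : ∑ c, ∑ d, F (π c) (π d) = ∑ c, ∑ d, F c d := by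
  rw [← Equiv.sum_comp π (fun c => ∑ d, F c d)]
  exact Finset.sum_congr rfl fun c _ => Equiv.sum_comp π _

theorem SOq.bialgHom_ext {f g : SOq s N →ₐc[ℂ] SOq s N}
    (h : ∀ a b, f (T s N a b) = g (T s N a b)) : f = g :=
  BialgHom.coe_toAlgHom_injective (SOq.algHom_ext h)

namespace IsMonomialSymm

theorem metric_perm (h : IsMonomialSymm s π e) (a b : Fin N) :
    metric s N (π a) (π b) = metric s N a b := by
  simp [metric, h.rho, ← h.rev]

theorem symm (h : IsMonomialSymm s π e) : IsMonomialSymm s π.symm fun a => (e (π.symm a))⁻¹ where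
  rev a := by rw [Equiv.symm_apply_eq, h.rev, Equiv.apply_symm_apply]
  rho a := by rw [← h.rho, Equiv.apply_symm_apply]
  rmat a b c d := by rw [← h.rmat]; simp only [Equiv.apply_symm_apply]
  weights a := by
    have : π.symm a.rev = (π.symm a).rev := by
      rw [Equiv.symm_apply_eq, h.rev, Equiv.apply_symm_apply]
    rw [this]
    exact inv_weights h.weights _

theorem prod_update (he : ∀ a, e a ≠ 0) {K : ℕ} (i : Fin K → Fin N) (k : Fin K) (c : Fin N) :
    ∏ m, e (Function.update i k c m) = (∏ m, e (i m)) * (e (i k))⁻¹ * e c := by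
  rw [← Finset.prod_erase_mul _ _ (Finset.mem_univ k),
    ← Finset.prod_erase_mul Finset.univ (fun m => e (i m)) (Finset.mem_univ k),
    mul_inv_cancel_right₀ (he _), Function.update_self]
  congr 1
  refine Finset.prod_congr rfl fun m hm => ?_
  rw [Function.update_of_ne (Finset.ne_of_mem_erase hm)]

/-- E ⊗ E commutes with R and preserves C, so E^{⊗N} acts on the space of epsilon tensors. The
dimension of that space is never needed, since the determinant relation is imposed for all of them.
-/
theorem isQEpsilon (h : IsMonomialSymm s π e) {ε : (Fin N → Fin N) → ℂ} (hε : IsQEpsilon s N ε) :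
    IsQEpsilon s N fun i => (∏ m, e (i m)) * ε (π ∘ i) := by
  have he := weight_ne_zero h.weights
  have hP (k : ℕ) (hk : k + 1 < N) (i : Fin N → Fin N) (c d : Fin N) :
      ∏ m, e (Function.update (Function.update i ⟨k, Nat.lt_of_succ_lt hk⟩ c) ⟨k + 1, hk⟩ d m) =
        (∏ m, e (i m)) * (e (i ⟨k + 1, hk⟩) * e (i ⟨k, Nat.lt_of_succ_lt hk⟩))⁻¹ *
          (e c * e d) := by
    rw [prod_update he, prod_update he, Function.update_of_ne (by simp [Fin.ext_iff]), mul_inv]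
    ring
  constructor
  · intro k hk i
    have := congrArg ((∏ m, e (i m)) * ·)
      ((sum_perm_pair π _).trans (hε.antisymm k hk (π ∘ i)))
    simp only [Function.comp_apply, h.rmat,
      Finset.mul_sum] at this
    refine Eq.trans ?_ (this.trans (by ring))
    refine Finset.sum_congr rfl fun c _ => Finset.sum_congr rfl fun d _ => ?_
    rw [hP, Function.comp_update, Function.comp_update]
    have hw := Rmat_mul_weights (s := s) h.weights (i ⟨k + 1, hk⟩)
      (i ⟨k, Nat.lt_of_succ_lt hk⟩) c d
    have h1 := he (i ⟨k + 1, hk⟩)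
    have h2 := he (i ⟨k, Nat.lt_of_succ_lt hk⟩)
    field_simp
    linear_combination (∏ m, e (i m)) * ε (Function.update (Function.update (π ∘ i)
      ⟨k, Nat.lt_of_succ_lt hk⟩ (π c)) ⟨k + 1, hk⟩ (π d)) * hw
  · intro k hk i
    have := congrArg ((∏ m, e (i m)) *
      (e (i ⟨k + 1, hk⟩) * e (i ⟨k, Nat.lt_of_succ_lt hk⟩))⁻¹ * ·)
      ((sum_perm_pair π _).trans (hε.traceless k hk (π ∘ i)))
    simp only [h.metric_perm, Finset.mul_sum, mul_zero] at this
    refine Eq.trans ?_ this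
    refine Finset.sum_congr rfl fun c _ => Finset.sum_congr rfl fun d _ => ?_
    rw [hP, Function.comp_update, Function.comp_update]
    have hw := metric_mul_weights (s := s) h.weights c d
    linear_combination (∏ m, e (i m)) * (e (i ⟨k + 1, hk⟩) * e (i ⟨k, Nat.lt_of_succ_lt hk⟩))⁻¹ *
      ε (Function.update (Function.update (π ∘ i)
      ⟨k, Nat.lt_of_succ_lt hk⟩ (π c)) ⟨k + 1, hk⟩ (π d)) * hw

theorem tens_monomialConj {B : Type*} [Ring B] [Algebra ℂ B] (t : Matrix (Fin N) (Fin N) B)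
    {K : ℕ} (i j : Fin K → Fin N) :
    tens (monomialConj π e t) i j =
      ((∏ m, e (i m)) * ∏ m, (e (j m))⁻¹) • tens t (π ∘ i) (π ∘ j) := by
  induction K with
  | zero => simp [tens_zero]
  | succ K ih =>
    rw [tens_succ, ih, tens_succ, Fin.prod_univ_succ, Fin.prod_univ_succ, monomialConj,
      smul_mul_smul_comm]
    congr 1
    simp only [Fin.tail]
    ring

theorem isQOrth (h : IsMonomialSymm s π e) {B : Type*} [Ring B] [Algebra ℂ B]
    {t : Matrix (Fin N) (Fin N) B} (ht : IsQOrth s t) : IsQOrth s (monomialConj π e t) where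
  rtt a b c d := by
    have := congrArg ((e a * e b * ((e c)⁻¹ * (e d)⁻¹)) • ·) (((sum_perm_pair π _).trans
      (ht.rtt (π a) (π b) (π c) (π d))).trans (sum_perm_pair π _).symm)
    simp only [h.rmat, Finset.smul_sum, smul_smul] at this
    refine Eq.trans (Finset.sum_congr rfl fun c' _ => Finset.sum_congr rfl fun d' _ => ?_)
      (this.trans (Finset.sum_congr rfl fun c' _ => Finset.sum_congr rfl fun d' _ => ?_))
    · rw [monomialConj, monomialConj, smul_mul_smul_comm, smul_smul]
      congr 1
      have := Rmat_mul_weights (s := s) h.weights a b c' d'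
      linear_combination (e c)⁻¹ * (e d)⁻¹ * this
    · rw [monomialConj, monomialConj, smul_mul_smul_comm, smul_smul]
      congr 1
      have := Rmat_mul_weights (s := s) (inv_weights h.weights) c' d' c d
      linear_combination e a * e b * this
  orth₁ a d := by
    have := congrArg ((e a * e d) • ·) ((sum_perm_pair π _).trans (ht.orth₁ (π a) (π d)))
    simp only [h.metric_perm, Finset.smul_sum,
      smul_smul] at this
    rw [mul_comm (e a * e d), metric_mul_weights h.weights] at this
    rw [← this]
    refine Finset.sum_congr rfl fun b _ => Finset.sum_congr rfl fun c _ => ?_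
    rw [monomialConj, monomialConj, smul_mul_smul_comm, smul_smul]
    congr 1
    have := metric_mul_weights (s := s) (inv_weights h.weights) b c
    linear_combination e a * e d * this
  orth₂ b d := by
    have := congrArg (((e b)⁻¹ * (e d)⁻¹) • ·) ((sum_perm_pair π _).trans (ht.orth₂ (π b) (π d)))
    simp only [h.metric_perm, Finset.smul_sum,
      smul_smul] at this
    rw [mul_comm ((e b)⁻¹ * (e d)⁻¹), metric_mul_weights (inv_weights h.weights)] at this
    rw [← this]
    refine Finset.sum_congr rfl fun a _ => Finset.sum_congr rfl fun c _ => ?_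
    rw [monomialConj, monomialConj, smul_mul_smul_comm, smul_smul]
    congr 1
    have := metric_mul_weights (s := s) h.weights a c
    linear_combination (e b)⁻¹ * (e d)⁻¹ * this
  det ε hε i := by
    have he := weight_ne_zero h.weights
    -- The determinant relation for E t E⁻¹ and ε is that for t and the tensor obtained from ε by
    -- E⁻¹ in every slot, with E applied afterwards.
    have := congrArg ((∏ m, e (i m)) • ·) (ht.det _ (h.symm.isQEpsilon hε) (π ∘ i))
    rw [← (Equiv.arrowCongr (Equiv.refl (Fin N)) π).sum_comp] at this
    simp only [Function.comp_apply, Equiv.symm_apply_apply, Equiv.arrowCongr_apply,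
      Equiv.coe_refl, Equiv.refl_symm, ← Function.comp_assoc, Equiv.symm_comp_self,
      Function.id_comp, Function.comp_id, Finset.smul_sum, smul_smul] at this
    rw [← mul_assoc, ← Finset.prod_mul_distrib, Finset.prod_congr rfl
      (fun m _ => mul_inv_cancel₀ (he (i m))), Finset.prod_const_one, one_mul] at this
    rw [← this]
    refine Finset.sum_congr rfl fun j _ => ?_
    have hj : π.symm ∘ (Equiv.refl (Fin N)).arrowCongr π j = j := by ext; simp
    rw [tens_monomialConj, smul_smul, hj]
    congr 1
    ring

/-- The algebra map `T ↦ E T E⁻¹`. -/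
def algHom (h : IsMonomialSymm s π e) : SOq s N →ₐ[ℂ] SOq s N :=
  SOq.lift (h.isQOrth (isQOrth_T s N))

theorem algHom_T (h : IsMonomialSymm s π e) (a b : Fin N) :
    h.algHom (T s N a b) = (e a * (e b)⁻¹) • T s N (π a) (π b) :=
  SOq.lift_T _ a b

/-- The bialgebra map `T ↦ E T E⁻¹`. -/
def bialgHom (h : IsMonomialSymm s π e) : SOq s N →ₐc[ℂ] SOq s N :=
  BialgHom.ofAlgHom h.algHom
    (by
      apply SOq.algHom_ext
      intro a b
      have he := weight_ne_zero h.weights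
      by_cases hab : a = b
      · subst hab; simp [algHom_T, counit_T, he]
      · simp [algHom_T, counit_T, hab])
    (by
      apply SOq.algHom_ext
      intro a b
      have he := weight_ne_zero h.weights
      simp only [AlgHom.comp_apply, algHom_T, Bialgebra.comulAlgHom_apply, comul_T, map_sum,
        map_smul, Algebra.TensorProduct.map_tmul, Finset.smul_sum]
      -- After relabelling the contracted index by π, its weight occurs as e_c and as its inverse on
      -- the two legs, and cancels.
      rw [← Equiv.sum_comp π (fun c => _ • T s N _ c ⊗ₜ[ℂ] T s N c _)]
      refine Finset.sum_congr rfl fun c _ => ?_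
      rw [TensorProduct.smul_tmul_smul]
      congr 1
      have := he c
      field_simp)

theorem bialgHom_T (h : IsMonomialSymm s π e) (a b : Fin N) :
    h.bialgHom (T s N a b) = (e a * (e b)⁻¹) • T s N (π a) (π b) :=
  h.algHom_T a b

end IsMonomialSymm

theorem antipodeMatrix_apply {B : Type*} [Ring B] [Algebra ℂ B] (t : Matrix (Fin N) (Fin N) B)
    (a b : Fin N) : antipodeMatrix s t a b =
      (metric s N a a.rev * metric s N b.rev b) • t b.rev a.rev := by
  rw [antipodeMatrix, Matrix.mul_apply, Finset.sum_eq_single b.rev, Matrix.mul_apply,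
    Finset.sum_eq_single a.rev]
  · simp only [metricB, Matrix.transpose_apply]
    rw [← Algebra.commutes, ← mul_assoc, ← map_mul, ← Algebra.smul_def, mul_comm]
  · intro c _ hc; simp [metricB, metric, hc]
  · simp
  · intro c _ hc
    have : b ≠ c.rev := fun h => hc (by simp [h])
    simp [metricB, metric, this]
  · simp

/-- An algebra map commutes with the antipode if it does so on the generators. -/
theorem antipode_comm_of_T (f : SOq s N →ₐc[ℂ] SOq s N)
    (hf : ∀ a b, antipodeLin s N (f (T s N a b)) = f (antipodeLin s N (T s N a b)))
    (x : SOq s N) : HopfAlgebra.antipode ℂ (f x) = f (HopfAlgebra.antipode ℂ x) := by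
  change antipodeLin s N (f x) = f (antipodeLin s N x)
  induction x using SOq.induction with
  | alg r =>
    rw [antipodeLin_algebraMap]
    have : f (algebraMap ℂ _ r) = algebraMap ℂ _ r := AlgHomClass.commutes f r
    rw [this, antipodeLin_algebraMap]
  | gen a b => exact hf a b
  | add x y hx hy => simp only [map_add, hx, hy]
  | mul x y hx hy => simp only [map_mul, antipodeLin_mul, hx, hy]

/-- The Hopf algebra automorphism `T ↦ E T E⁻¹` for a monomial symmetry `E`. -/
def IsMonomialSymm.aut (h : IsMonomialSymm s π e) : HopfAut (SOq s N) where
  toEquiv := BialgEquiv.ofBialgHom h.bialgHom h.symm.bialgHom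
    (SOq.bialgHom_ext fun a b => by
      have he := weight_ne_zero h.weights
      have h1 := he (π.symm a)
      have h2 := he (π.symm b)
      simp only [BialgHom.comp_apply, bialgHom_T, map_smul, smul_smul, BialgHom.id_apply,
        Equiv.apply_symm_apply]
      field_simp
      simp)
    (SOq.bialgHom_ext fun a b => by
      have he := weight_ne_zero h.weights
      have h1 := he a
      have h2 := he b
      simp only [BialgHom.comp_apply, bialgHom_T, map_smul, smul_smul, BialgHom.id_apply,
        Equiv.symm_apply_apply]
      field_simp
      simp)
  antipode_comm := antipode_comm_of_T h.bialgHom fun a b => by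
    have h1 := metric_mul_weights (s := s) h.weights
    have he := weight_ne_zero h.weights
    have w (a) : e a.rev = (e a)⁻¹ := eq_inv_of_mul_eq_one_right (h.weights a)
    simp only [h.bialgHom_T, map_smul, antipodeLin_T, antipodeMatrix_apply, smul_smul, ← h.rev,
      h.metric_perm, w, inv_inv]
    congr 1
    ring

theorem IsMonomialSymm.aut_T (h : IsMonomialSymm s π e) (a b : Fin N) :
    h.aut (T s N a b) = (e a * (e b)⁻¹) • T s N (π a) (π b) :=
  h.bialgHom_T a b

theorem IsMonomialSymm.actsBy (h : IsMonomialSymm s π e) : ActsBy h.aut (monomialMatrix π e) := by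
  intro a b
  rw [sum_monomialMatrix (weight_ne_zero h.weights), h.aut_T]
  rfl

end Monomial

/-! ### The symmetries `♯`, `♮`, and the diagonal automorphisms -/

section Symmetries

variable {s : ℂˣ} {N : ℕ}

theorem IsMonomialSymm.diagonal {e : Fin N → ℂ} (he : ∀ a, e a * e a.rev = 1) :
    IsMonomialSymm s 1 e where
  rev _ := rfl
  rho _ := rfl
  rmat _ _ _ _ := rfl
  weights := he

theorem monomialMatrix_one (e : Fin N → ℂ) : monomialMatrix 1 e = Matrix.diagonal e := by
  ext a b
  simp [monomialMatrix, Matrix.diagonal_apply, eq_comm]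

theorem isMiddle_rev {a : Fin N} : IsMiddle a.rev ↔ IsMiddle a := by
  simp [IsMiddle, and_comm]

theorem isMiddle_iff_of_odd (hN : Odd N) {a : Fin N} : IsMiddle a ↔ a = a.rev := by
  obtain ⟨n, rfl⟩ := hN
  simp only [IsMiddle, Fin.ext_iff, Fin.val_rev]
  lia

theorem isMiddle_iff_of_even {n : ℕ} (hN : N = 2 * n) {a : Fin N} :
    IsMiddle a ↔ (a : ℕ) = n ∨ (a : ℕ) + 1 = n := by
  subst hN
  simp only [IsMiddle, Fin.val_rev]
  lia

/-- For even N both middle entries of ρ vanish, so their exchange leaves C and the powers q^ρ in R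
unchanged. -/
theorem twoRho_of_isMiddle (hN : Even N) {a : Fin N} (ha : IsMiddle a) : twoRho N a = 0 := by
  obtain ⟨n, hn⟩ := hN
  rw [isMiddle_iff_of_even (n := n) (by lia)] at ha
  simp only [twoRho, Fin.lt_def, Fin.ext_iff, Fin.val_rev]
  split_ifs <;> grind

open Classical in
/-- The permutation in the monomial matrix `𝒟`. -/
def sharpPerm (N : ℕ) : Equiv.Perm (Fin N) :=
  Function.Involutive.toPerm (fun a => if Even N ∧ IsMiddle a then a.rev else a) fun a => by
    by_cases h : Even N ∧ IsMiddle a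
    · simp [h, isMiddle_rev]
    · simp [h]

open Classical in
/-- The nonzero entries of the monomial matrix `𝒟`. -/
def sharpWeight (N : ℕ) (a : Fin N) : ℂ := if Odd N ∧ IsMiddle a then -1 else 1

open Classical in
theorem sharpPerm_apply (a : Fin N) :
    sharpPerm N a = if Even N ∧ IsMiddle a then a.rev else a := rfl

theorem sharpPerm_sharpPerm (a : Fin N) : sharpPerm N (sharpPerm N a) = a :=
  Function.Involutive.toPerm_involutive _ a

theorem sharpPerm_of_isMiddle (hN : Even N) {a : Fin N} (ha : IsMiddle a) :
    sharpPerm N a = a.rev := by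
  simp [sharpPerm_apply, hN, ha]

theorem sharpPerm_of_not_isMiddle {a : Fin N} (ha : ¬ IsMiddle a) : sharpPerm N a = a := by
  simp [sharpPerm_apply, ha]

theorem sharpPerm_of_odd (hN : Odd N) : sharpPerm N = 1 := by
  ext a
  simp [sharpPerm_apply, Nat.not_even_iff_odd.2 hN]

theorem isMiddle_sharpPerm {a : Fin N} : IsMiddle (sharpPerm N a) ↔ IsMiddle a := by
  simp only [sharpPerm_apply]
  split_ifs
  · exact isMiddle_rev
  · rfl

theorem sharpPerm_rev (a : Fin N) : sharpPerm N a.rev = (sharpPerm N a).rev := by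
  by_cases h : Even N ∧ IsMiddle a <;> simp [sharpPerm_apply, h, isMiddle_rev]

theorem monomialMatrix_sharp (N : ℕ) :
    monomialMatrix (sharpPerm N) (sharpWeight N) = sharpMatrix N := by
  ext a b
  by_cases hN : Odd N
  · rw [sharpPerm_of_odd hN]
    by_cases h : IsMiddle a <;> simp [monomialMatrix, sharpMatrix, sharpWeight, hN, h]
  · by_cases h : IsMiddle a
    · simp [monomialMatrix, sharpMatrix, sharpWeight, hN, h,
        sharpPerm_of_isMiddle (Nat.not_odd_iff_even.1 hN) h]
    · simp [monomialMatrix, sharpMatrix, sharpWeight, h, sharpPerm_of_not_isMiddle h]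

/-- For even `N`, the terms of the R-matrix that depend on the order of the two middle indices
cancel. -/
theorem Rmat_eq_of_even (hN : Even N) (s : ℂˣ) (a b c d : Fin N) [DecidablePred (@IsMiddle N)] :
    Rmat s N a b c d = (if a = c ∧ b = d then rdiag s a b else 0)
    + (if a = d ∧ b = c ∧ b < a ∧ ¬ (IsMiddle a ∧ IsMiddle b) then qpar s - (qpar s)⁻¹ else 0)
    - (if b = a.rev ∧ d = c.rev ∧ c < a ∧ ¬ (IsMiddle a ∧ IsMiddle c) then
      (qpar s - (qpar s)⁻¹) * (qrho s a * (qrho s c)⁻¹) else 0) := by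
  have hpair {a b : Fin N} (ha : IsMiddle a) (hb : IsMiddle b) (hab : b < a) : b = a.rev := by
    obtain ⟨n, hn⟩ := hN
    rw [isMiddle_iff_of_even (by lia : N = 2 * n)] at ha hb
    simp only [Fin.ext_iff, Fin.lt_def, Fin.val_rev] at hab ⊢
    lia
  rw [Rmat_eq]
  by_cases h : b = a.rev ∧ d = c.rev ∧ c < a ∧ IsMiddle a ∧ IsMiddle c
  -- Here c = a', so the flip and metric parts sit on the same entry, with opposite signs and q^{ρ_a
  -- - ρ_c} = 1.
  · obtain ⟨rfl, rfl, h1, h2, h3⟩ := h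
    obtain rfl := hpair h2 h3 h1
    simp [h1, h2, h3, qrho, twoRho_of_isMiddle hN]
  · have e1 : (a = d ∧ b = c ∧ b < a) ↔
        (a = d ∧ b = c ∧ b < a ∧ ¬ (IsMiddle a ∧ IsMiddle b)) := by
      refine ⟨fun ⟨h1, h2, h3⟩ => ⟨h1, h2, h3, fun ⟨h4, h5⟩ => h ?_⟩,
        fun ⟨h1, h2, h3, _⟩ => ⟨h1, h2, h3⟩⟩
      have := hpair h4 h5 h3
      exact ⟨this, by rw [← h1, ← h2, this, Fin.rev_rev], h2 ▸ h3, h4, h2 ▸ h5⟩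
    have e2 : (b = a.rev ∧ d = c.rev ∧ c < a) ↔
        (b = a.rev ∧ d = c.rev ∧ c < a ∧ ¬ (IsMiddle a ∧ IsMiddle c)) :=
      ⟨fun ⟨h1, h2, h3⟩ => ⟨h1, h2, h3, fun h4 => h ⟨h1, h2, h3, h4⟩⟩,
        fun ⟨h1, h2, h3, _⟩ => ⟨h1, h2, h3⟩⟩
    simp only [← e1, ← e2]

theorem twoRho_sharpPerm (a : Fin N) : twoRho N (sharpPerm N a) = twoRho N a := by
  by_cases h : Even N ∧ IsMiddle a
  · rw [sharpPerm_of_isMiddle h.1 h.2, twoRho_of_isMiddle h.1 h.2,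
      twoRho_of_isMiddle h.1 (isMiddle_rev.2 h.2)]
  · simp [sharpPerm_apply, h]

/-- Exchanging two adjacent indices alters no order comparison except the one between them, and
`Rmat_eq_of_even` removes that comparison from R. -/
theorem Rmat_sharpPerm (a b c d : Fin N) :
    Rmat s N (sharpPerm N a) (sharpPerm N b) (sharpPerm N c) (sharpPerm N d) =
      Rmat s N a b c d := by
  classical
  by_cases hN : Odd N
  · rw [sharpPerm_of_odd hN]; rfl
  · rw [Nat.not_odd_iff_even] at hN
    have hlt (a b : Fin N) : (sharpPerm N b < sharpPerm N a ∧ ¬ (IsMiddle a ∧ IsMiddle b)) ↔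
        (b < a ∧ ¬ (IsMiddle a ∧ IsMiddle b)) := by
      obtain ⟨n, hn⟩ := hN
      have hm {a : Fin N} := isMiddle_iff_of_even (by lia : N = 2 * n) (a := a)
      by_cases ha : IsMiddle a <;> by_cases hb : IsMiddle b
      · simp [ha, hb]
      · rw [sharpPerm_of_isMiddle ⟨n, hn⟩ ha, sharpPerm_of_not_isMiddle hb]
        rw [hm] at ha hb
        simp only [Fin.lt_def, Fin.val_rev, hm]
        lia
      · rw [sharpPerm_of_isMiddle ⟨n, hn⟩ hb, sharpPerm_of_not_isMiddle ha]
        rw [hm] at ha hb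
        simp only [Fin.lt_def, Fin.val_rev, hm]
        lia
      · rw [sharpPerm_of_not_isMiddle ha, sharpPerm_of_not_isMiddle hb]
    have hd (a b : Fin N) : rdiag s (sharpPerm N a) (sharpPerm N b) = rdiag s a b := by
      simp only [rdiag, ← sharpPerm_rev, EmbeddingLike.apply_eq_iff_eq]
    have hz (a : Fin N) : qrho s (sharpPerm N a) = qrho s a := by
      simp only [qrho, twoRho_sharpPerm]
    rw [Rmat_eq_of_even hN, Rmat_eq_of_even hN]
    simp only [isMiddle_sharpPerm, hlt, ← sharpPerm_rev, EmbeddingLike.apply_eq_iff_eq, hd, hz]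

theorem sharpWeight_eq_one_or (a : Fin N) : sharpWeight N a = 1 ∨ sharpWeight N a = -1 := by
  unfold sharpWeight
  split_ifs <;> simp

theorem sharpWeight_rev (a : Fin N) : sharpWeight N a.rev = sharpWeight N a := by
  unfold sharpWeight
  rw [isMiddle_rev]

theorem sharpWeight_mul_self (a : Fin N) : sharpWeight N a * sharpWeight N a = 1 := by
  rcases sharpWeight_eq_one_or a with h | h <;> simp [h]

theorem sharpWeight_sharpPerm (a : Fin N) : sharpWeight N (sharpPerm N a) = sharpWeight N a := by
  unfold sharpWeight
  rw [isMiddle_sharpPerm]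

theorem isMonomialSymm_sharp (s : ℂˣ) (N : ℕ) :
    IsMonomialSymm s (sharpPerm N) (sharpWeight N) where
  rev := sharpPerm_rev
  rho := twoRho_sharpPerm
  rmat := Rmat_sharpPerm
  weights a := by rw [sharpWeight_rev, sharpWeight_mul_self]

/-- The diagonal entries of `alphaMatrix`. -/
def alphaWeight (N : ℕ) (a : Fin N) : ℂ :=
  if a < a.rev then Complex.I else if a = a.rev then 1 else -Complex.I

theorem alphaWeight_mul_rev (a : Fin N) : alphaWeight N a * alphaWeight N a.rev = 1 := by
  unfold alphaWeight
  rcases lt_trichotomy a a.rev with h | h | h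
  · simp [h, h.not_gt, h.ne']
  · rw [← h]; simp [← h]
  · simp [h, h.not_gt, h.ne']

/-- Outside the middle α is ±i, which equals minus its conjugate; in the middle α = 1 and the sign
comes from 𝒟. The common minus sign is harmless, since only ratios of weights act on T. -/
theorem sharpWeight_mul_alphaWeight (hN : Odd N) (a : Fin N) :
    sharpWeight N a * alphaWeight N a = -starRingEnd ℂ (alphaWeight N a) := by
  unfold sharpWeight alphaWeight
  simp only [hN, true_and, isMiddle_iff_of_odd hN]
  rcases lt_trichotomy a a.rev with h | h | h
  · simp [h, h.ne]
  · simp [← h]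
  · simp [h.not_gt, h.ne']

open Classical in
/-- The diagonal entries of `sigmaMatrix`. -/
def sigmaWeight (ε : Fin N → ℂ) (a : Fin N) : ℂ :=
  if ε a = 1 then 1 else if a < a.rev then Complex.I else -Complex.I

theorem IsSigns.eq_one_or {ε : Fin N → ℂ} (hε : IsSigns ε) (a : Fin N) : ε a = 1 ∨ ε a = -1 :=
  sq_eq_one_iff.1 (hε.sq a)

theorem IsSigns.mul_self {ε : Fin N → ℂ} (hε : IsSigns ε) (a : Fin N) : ε a * ε a = 1 := by
  rw [← pow_two, hε.sq]

theorem IsSigns.mul_rev {ε : Fin N → ℂ} (hε : IsSigns ε) (a : Fin N) : ε a * ε a.rev = 1 := by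
  rw [hε.rev, hε.mul_self]

theorem IsSigns.comp_sharpPerm {ε : Fin N → ℂ} (hε : IsSigns ε) (a : Fin N) :
    ε (sharpPerm N a) = ε a := by
  by_cases h : Even N ∧ IsMiddle a <;> simp [sharpPerm_apply, h, hε.rev]

/-- The condition on the middle signs makes both middle weights 1. This is why β is compatible with
the permutation part of ♯. -/
theorem IsSigns.sigmaWeight_comp_sharpPerm {ε : Fin N → ℂ} (hε : IsSigns ε) (a : Fin N) :
    sigmaWeight ε (sharpPerm N a) = sigmaWeight ε a := by
  by_cases h : Even N ∧ IsMiddle a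
  · rw [sharpPerm_of_isMiddle h.1 h.2]
    simp [sigmaWeight, hε.rev, hε.middle a h.2]
  · simp [sharpPerm_apply, h]

theorem IsSigns.sigmaWeight_mul_rev {ε : Fin N → ℂ} (hε : IsSigns ε) (a : Fin N) :
    sigmaWeight ε a * sigmaWeight ε a.rev = 1 := by
  unfold sigmaWeight
  by_cases h : ε a = 1
  · simp [h, hε.rev]
  · have hne : a ≠ a.rev := fun h' => h (hε.middle a (by rw [IsMiddle, ← h']; simp))
    rcases hne.lt_or_gt with h' | h'
    · simp [h', h'.not_gt, h, hε.rev]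
    · simp [h', h'.not_gt, h, hε.rev]

/-- A weight ±i is sent to its conjugate by the sign -1, and a weight 1 is real. This identity is
the whole reason β carries ×^♮ to ×. -/
theorem IsSigns.mul_sigmaWeight {ε : Fin N → ℂ} (hε : IsSigns ε) (a : Fin N) :
    ε a * sigmaWeight ε a = starRingEnd ℂ (sigmaWeight ε a) := by
  unfold sigmaWeight
  rcases hε.eq_one_or a with h | h
  · simp [h]
  · have : ¬ ((-1 : ℂ) = 1) := by norm_num
    by_cases h' : a < a.rev <;> simp [h, this, h']

end Symmetries

/-! ### Composites of star structures and automorphisms -/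

section Composites

variable {A : Type*} [Ring A] [HopfAlgebra ℂ A]

theorem HopfStar.map_one (σ : HopfStar A) : σ 1 = 1 := by
  have := σ.antimul (σ 1) 1
  rw [mul_one, σ.invol, mul_one] at this
  exact this.symm

theorem HopfStar.map_algebraMap (σ : HopfStar A) (c : ℂ) :
    σ (algebraMap ℂ A c) = algebraMap ℂ A (starRingEnd ℂ c) := by
  rw [Algebra.algebraMap_eq_smul_one, map_smulₛₗ, σ.map_one, ← Algebra.algebraMap_eq_smul_one]

theorem HopfAut.map_algebraMap (φ : HopfAut A) (c : ℂ) :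
    φ (algebraMap ℂ A c) = algebraMap ℂ A c :=
  AlgHomClass.commutes φ.toEquiv c

theorem HopfAut.comul (φ : HopfAut A) (x : A) : Coalgebra.comul (R := ℂ) (φ x) =
    TensorProduct.map (φ.toEquiv : A →ₗ[ℂ] A) (φ.toEquiv : A →ₗ[ℂ] A)
      (Coalgebra.comul (R := ℂ) x) :=
  (CoalgHomClass.map_comp_comul_apply φ.toEquiv x).symm

/-- The star structure `φ ∘ σ`, for an involutive automorphism `φ` that commutes with `σ`. -/
def HopfAut.compStar (φ : HopfAut A) (σ : HopfStar A) (hφ : ∀ x, φ (φ x) = x)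
    (h : ∀ x, φ (σ x) = σ (φ x)) : HopfStar A where
  toMap := (φ.toEquiv : A →ₗ[ℂ] A).comp σ.toMap
  antimul x y := by
    change φ (σ (x * y)) = φ (σ y) * φ (σ x)
    rw [σ.antimul, map_mul]
  comul_star x := by
    change Coalgebra.comul (R := ℂ) (φ (σ x)) = _
    rw [φ.comul, σ.comul_star]
    induction Coalgebra.comul (R := ℂ) x using TensorProduct.induction_on with
    | zero => simp
    | add x y hx hy => simp only [map_add, hx, hy]
    | tmul x y => simp
  counit_star x := by
    change Coalgebra.counit (R := ℂ) (φ (σ x)) = _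
    rw [← σ.counit_star]
    exact CoalgHomClass.counit_comp_apply φ.toEquiv (σ x)
  invol x := by
    change φ (σ (φ (σ x))) = x
    rw [← h, hφ, σ.invol]

/-- The composite of two Hopf algebra automorphisms. -/
def HopfAut.trans (φ ψ : HopfAut A) : HopfAut A where
  toEquiv := φ.toEquiv.trans ψ.toEquiv
  antipode_comm x := by
    change HopfAlgebra.antipode ℂ (ψ (φ x)) = ψ (φ (HopfAlgebra.antipode ℂ x))
    rw [ψ.antipode_comm, φ.antipode_comm]

theorem HopfStar.equivalent_of_comm {σ τ : HopfStar A} (α : HopfAut A)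
    (h : ∀ x, α (σ x) = τ (α x)) : σ.Equivalent τ := by
  refine ⟨α, fun x => ?_⟩
  rw [h]
  congr 1
  exact (α.toEquiv.apply_symm_apply x).symm

theorem HopfStar.Equivalent.trans {σ τ υ : HopfStar A} (h₁ : σ.Equivalent τ)
    (h₂ : τ.Equivalent υ) : σ.Equivalent υ := by
  obtain ⟨α, hα⟩ := h₁
  obtain ⟨β, hβ⟩ := h₂
  refine ⟨α.trans β, fun x => ?_⟩
  rw [hβ, hα]
  rfl

variable {s : ℂˣ} {N : ℕ}

/-- An antilinear antimultiplicative unital self-map of `SO_q(N)`. -/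
structure IsAntiHom (f : SOq s N → SOq s N) : Prop where
  alg : ∀ c, f (algebraMap ℂ _ c) = algebraMap ℂ _ (starRingEnd ℂ c)
  add : ∀ x y, f (x + y) = f x + f y
  mul : ∀ x y, f (x * y) = f y * f x

theorem HopfStar.isAntiHom (σ : HopfStar (SOq s N)) : IsAntiHom σ :=
  ⟨σ.map_algebraMap, map_add σ.toMap, σ.antimul⟩

theorem IsAntiHom.aut_comp {f : SOq s N → SOq s N} (hf : IsAntiHom f) (φ : HopfAut (SOq s N)) :
    IsAntiHom fun x => φ (f x) where
  alg c := by rw [hf.alg, φ.map_algebraMap]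
  add x y := by rw [hf.add, map_add]
  mul x y := by rw [hf.mul, map_mul]

theorem IsAntiHom.comp_aut {f : SOq s N → SOq s N} (hf : IsAntiHom f) (φ : HopfAut (SOq s N)) :
    IsAntiHom fun x => f (φ x) where
  alg c := by rw [φ.map_algebraMap, hf.alg]
  add x y := by rw [map_add, hf.add]
  mul x y := by rw [map_mul, hf.mul]

/-- No coproduct condition is required, so composites of a star structure with an automorphism on
either side qualify. Identities such as α ∘ ×^♯ = × ∘ α become comparisons of coefficients on T. -/
theorem IsAntiHom.ext {f g : SOq s N → SOq s N} (hf : IsAntiHom f) (hg : IsAntiHom g)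
    (h : ∀ a b, f (T s N a b) = g (T s N a b)) (x : SOq s N) : f x = g x := by
  induction x using SOq.induction with
  | alg r => rw [hf.alg, hg.alg]
  | gen a b => exact h a b
  | add x y hx hy => rw [hf.add, hg.add, hx, hy]
  | mul x y hx hy => rw [hf.mul, hg.mul, hx, hy]

theorem HopfAut.comm_of_T (φ ψ : HopfAut (SOq s N))
    (h : ∀ a b, φ (ψ (T s N a b)) = ψ (φ (T s N a b))) (x : SOq s N) :
    φ (ψ x) = ψ (φ x) := by
  induction x using SOq.induction with
  | alg r => simp only [HopfAut.map_algebraMap]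
  | gen a b => exact h a b
  | add x y hx hy => simp only [map_add, hx, hy]
  | mul x y hx hy => simp only [map_mul, hx, hy]

theorem HopfAut.involutive_of_T (φ : HopfAut (SOq s N))
    (h : ∀ a b, φ (φ (T s N a b)) = T s N a b) (x : SOq s N) : φ (φ x) = x := by
  induction x using SOq.induction with
  | alg r => simp only [HopfAut.map_algebraMap]
  | gen a b => exact h a b
  | add x y hx hy => simp only [map_add, hx, hy]
  | mul x y hx hy => simp only [map_mul, hx, hy]

theorem cross_smul (hs : ‖(s : ℂ)‖ = 1) (c : ℂ) (x : SOq s N) :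
    cross N hs (c • x) = starRingEnd ℂ c • cross N hs x :=
  map_smulₛₗ (cross N hs).toMap c x

theorem HopfAut.map_smul (φ : HopfAut A) (c : ℂ) (x : A) : φ (c • x) = c • φ x :=
  _root_.map_smul φ.toEquiv c x

/-- The automorphism `♯`. -/
def sharp (s : ℂˣ) (N : ℕ) : HopfAut (SOq s N) := (isMonomialSymm_sharp s N).aut

theorem sharp_T (a b : Fin N) : sharp s N (T s N a b) =
    (sharpWeight N a * sharpWeight N b) • T s N (sharpPerm N a) (sharpPerm N b) := by
  rw [sharp, IsMonomialSymm.aut_T, inv_eq_of_mul_eq_one_left (sharpWeight_mul_self b)]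

theorem conj_sharpWeight (a : Fin N) : starRingEnd ℂ (sharpWeight N a) = sharpWeight N a := by
  rcases sharpWeight_eq_one_or a with h | h <;> simp [h]

theorem sharp_sharp (x : SOq s N) : sharp s N (sharp s N x) = x := by
  refine (sharp s N).involutive_of_T (fun a b => ?_) x
  rw [sharp_T, HopfAut.map_smul, sharp_T, smul_smul, sharpWeight_sharpPerm, sharpWeight_sharpPerm,
    sharpPerm_sharpPerm, sharpPerm_sharpPerm, mul_mul_mul_comm, sharpWeight_mul_self,
    sharpWeight_mul_self, mul_one, one_smul]

theorem sharp_cross (hs : ‖(s : ℂ)‖ = 1) (x : SOq s N) :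
    sharp s N (cross N hs x) = cross N hs (sharp s N x) := by
  refine ((cross N hs).isAntiHom.aut_comp _).ext ((cross N hs).isAntiHom.comp_aut _)
    (fun a b => ?_) x
  simp only [cross_T, sharp_T, cross_smul, map_mul, conj_sharpWeight]

/-- The star structure `×^♯`. -/
def crossSharp (N : ℕ) (hs : ‖(s : ℂ)‖ = 1) : HopfStar (SOq s N) :=
  (sharp s N).compStar (cross N hs) sharp_sharp (sharp_cross hs)

theorem crossSharp_apply (hs : ‖(s : ℂ)‖ = 1) (x : SOq s N) :
    crossSharp N hs x = sharp s N (cross N hs x) := rfl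

theorem sharp_actsBy : ActsBy (sharp s N) (sharpMatrix N) := by
  rw [← monomialMatrix_sharp]
  exact (isMonomialSymm_sharp s N).actsBy

theorem cross_actsBy (hs : ‖(s : ℂ)‖ = 1) : ActsBy (cross N hs) 1 := by
  have h := (IsMonomialSymm.diagonal (s := s) (e := fun _ : Fin N => 1) (by simp)).actsBy
  rw [monomialMatrix_one, Matrix.diagonal_one] at h
  intro a b
  rw [← h a b, IsMonomialSymm.aut_T, cross_T]
  simp

/-- The automorphism `T ↦ A T A⁻¹` for a diagonal matrix `A`. -/
def diagAut {e : Fin N → ℂ} (he : ∀ a, e a * e a.rev = 1) : HopfAut (SOq s N) :=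
  (IsMonomialSymm.diagonal he).aut

theorem diagAut_T {e : Fin N → ℂ} (he : ∀ a, e a * e a.rev = 1) (a b : Fin N) :
    diagAut he (T s N a b) = (e a * (e b)⁻¹) • T s N a b :=
  IsMonomialSymm.aut_T _ a b

theorem diagAut_actsBy {e : Fin N → ℂ} (he : ∀ a, e a * e a.rev = 1) :
    ActsBy (diagAut (s := s) he) (Matrix.diagonal e) := by
  rw [← monomialMatrix_one]
  exact IsMonomialSymm.actsBy _

/-- For odd N both 𝒟 and A are diagonal, so on T^a_b the claim is that d_a d_b α_a/α_b equals the
conjugate of α_a/α_b. It follows from `sharpWeight_mul_alphaWeight` at a and at b. -/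
theorem exists_alpha (hs : ‖(s : ℂ)‖ = 1) (hN : Odd N) :
    ∃ alpha : HopfAut (SOq s N), ActsBy alpha (alphaMatrix N) ∧
      ∀ x, alpha (crossSharp N hs x) = cross N hs (alpha x) := by
  refine ⟨diagAut alphaWeight_mul_rev, diagAut_actsBy _, fun x => ?_⟩
  refine ((crossSharp N hs).isAntiHom.aut_comp _).ext ((cross N hs).isAntiHom.comp_aut _)
    (fun a b => ?_) x
  rw [crossSharp_apply, cross_T, sharp_T, HopfAut.map_smul, diagAut_T, diagAut_T, cross_smul,
    cross_T, sharpPerm_of_odd hN]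
  simp only [Equiv.Perm.one_apply, smul_smul]
  congr 1
  have ha := sharpWeight_mul_alphaWeight hN a
  have hb := sharpWeight_mul_alphaWeight hN b
  have h1 : alphaWeight N b ≠ 0 := weight_ne_zero alphaWeight_mul_rev b
  have h2 : starRingEnd ℂ (alphaWeight N b) ≠ 0 := by simpa using h1
  have h3 := sharpWeight_mul_self b
  rw [map_mul, map_inv₀]
  field_simp
  -- The two minus signs in `ha` and `hb` cancel, and d_b² = 1 removes the remaining factor.
  linear_combination (sharpWeight N b * starRingEnd ℂ (alphaWeight N b)) * ha -
    starRingEnd ℂ (alphaWeight N a) * sharpWeight N b * hb +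
    starRingEnd ℂ (alphaWeight N a) * alphaWeight N b * h3

/-- A single β serves both equivalences: ε and σ take equal values on indices exchanged by ♯, so the
coefficient identity for × also handles ×^♯. -/
theorem exists_natural (hs : ‖(s : ℂ)‖ = 1) {ε : Fin N → ℂ} (hε : IsSigns ε) :
    ∃ (natural beta : HopfAut (SOq s N)) (crossNat crossSharpNat : HopfStar (SOq s N)),
      ActsBy natural (Matrix.diagonal ε) ∧
      (∀ x, natural (natural x) = x) ∧
      (∀ x, natural (sharp s N x) = sharp s N (natural x)) ∧
      (∀ x, crossNat x = natural (cross N hs x)) ∧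
      (∀ x, crossNat x = cross N hs (natural x)) ∧
      (∀ x, crossSharpNat x = natural (sharp s N (cross N hs x))) ∧
      (∀ x, crossSharpNat x = cross N hs (natural (sharp s N x))) ∧
      ActsBy beta (sigmaMatrix ε) ∧
      (∀ x, beta (crossNat x) = cross N hs (beta x)) ∧
      (∀ x, beta (crossSharpNat x) = crossSharp N hs (beta x)) := by
  have hinv (a) : (ε a)⁻¹ = ε a := (eq_inv_of_mul_eq_one_left (hε.mul_self a)).symm
  have hconj (a) : starRingEnd ℂ (ε a) = ε a := by
    rcases hε.eq_one_or a with h | h <;> simp [h]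
  set natural : HopfAut (SOq s N) := diagAut hε.mul_rev
  set beta : HopfAut (SOq s N) := diagAut hε.sigmaWeight_mul_rev
  have hT (a b) : natural (T s N a b) = (ε a * ε b) • T s N a b := by rw [diagAut_T, hinv]
  have h1 (x) : natural (natural x) = x := by
    refine natural.involutive_of_T (fun a b => ?_) x
    rw [hT, HopfAut.map_smul, hT, smul_smul, mul_mul_mul_comm, hε.mul_self, hε.mul_self, mul_one,
      one_smul]
  have h2 (x) : natural (sharp s N x) = sharp s N (natural x) := by
    refine natural.comm_of_T _ (fun a b => ?_) x
    rw [hT, HopfAut.map_smul, sharp_T, HopfAut.map_smul, hT, smul_smul, smul_smul,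
      hε.comp_sharpPerm, hε.comp_sharpPerm, mul_comm]
  have h3 (x) : natural (cross N hs x) = cross N hs (natural x) := by
    refine ((cross N hs).isAntiHom.aut_comp _).ext ((cross N hs).isAntiHom.comp_aut _)
      (fun a b => ?_) x
    rw [cross_T, hT, cross_smul, cross_T, map_mul, hconj, hconj]
  have h4 (x) : natural (crossSharp N hs x) = crossSharp N hs (natural x) := by
    rw [crossSharp_apply, crossSharp_apply, h2, h3]
  set crossNat := natural.compStar (cross N hs) h1 h3
  set crossSharpNat := natural.compStar (crossSharp N hs) h1 h4
  have hw (a) : sigmaWeight ε a ≠ 0 := weight_ne_zero hε.sigmaWeight_mul_rev a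
  -- The left side is the coefficient of T^a_b after ×, ♮ and β; the right side is the one after β
  -- and ×.
  have key (a b) : ε a * ε b * (sigmaWeight ε a * (sigmaWeight ε b)⁻¹) =
      starRingEnd ℂ (sigmaWeight ε a * (sigmaWeight ε b)⁻¹) := by
    rw [map_mul, map_inv₀, ← hε.mul_sigmaWeight, ← hε.mul_sigmaWeight, mul_inv, hinv]
    ring
  refine ⟨natural, beta, crossNat, crossSharpNat, diagAut_actsBy _, h1, h2, fun _ => rfl, h3,
    fun _ => rfl, fun x => ?_, diagAut_actsBy _, fun x => ?_, fun x => ?_⟩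
  · change natural (sharp s N (cross N hs x)) = _
    rw [sharp_cross, h3]
  · refine (crossNat.isAntiHom.aut_comp _).ext ((cross N hs).isAntiHom.comp_aut _)
      (fun a b => ?_) x
    change beta (natural (cross N hs _)) = _
    rw [cross_T, hT, HopfAut.map_smul, diagAut_T, cross_smul, cross_T, smul_smul, key]
  · refine (crossSharpNat.isAntiHom.aut_comp _).ext ((crossSharp N hs).isAntiHom.comp_aut _)
      (fun a b => ?_) x
    change beta (natural (sharp s N (cross N hs _))) = sharp s N (cross N hs _)
    rw [cross_T, sharp_T, HopfAut.map_smul, hT, HopfAut.map_smul, HopfAut.map_smul, diagAut_T,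
      diagAut_T, cross_smul, cross_T, HopfAut.map_smul, sharp_T, smul_smul, smul_smul, smul_smul,
      hε.comp_sharpPerm, hε.comp_sharpPerm, hε.sigmaWeight_comp_sharpPerm,
      hε.sigmaWeight_comp_sharpPerm, mul_assoc, key, mul_comm]

end Composites

/-! ### The classical case `s = 1` -/

section Classical

variable {N : ℕ}

theorem Rmat_classical (a b c d : Fin N) : Rmat 1 N a b c d = if a = c ∧ b = d then 1 else 0 := by
  simp [Rmat, qpar]

theorem metric_classical (a b : Fin N) : metric 1 N a b = if b = a.rev then 1 else 0 := by
  simp [metric]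

theorem metric_classical_transpose : (metric 1 N).transpose = metric 1 N := by
  ext a b
  have : a = b.rev ↔ b = a.rev := ⟨fun h => by simp [h], fun h => by simp [h]⟩
  simp only [Matrix.transpose_apply, metric_classical, this]

/-- The sign of a map `i`, zero if `i` is not bijective. -/
def leviCivita (i : Fin N → Fin N) : ℂ := ((1 : Matrix (Fin N) (Fin N) ℂ).submatrix i id).det

theorem leviCivita_comp_perm (i : Fin N → Fin N) (σ : Equiv.Perm (Fin N)) :
    leviCivita (i ∘ σ) = (Equiv.Perm.sign σ : ℂ) * leviCivita i :=
  Matrix.det_permute σ ((1 : Matrix (Fin N) (Fin N) ℂ).submatrix i id)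

theorem leviCivita_id : leviCivita (id : Fin N → Fin N) = 1 := by
  simp [leviCivita]

theorem leviCivita_of_not_injective {i : Fin N → Fin N} (hi : ¬ Function.Injective i) :
    leviCivita i = 0 := by
  simp only [Function.Injective, not_forall] at hi
  obtain ⟨a, b, h, hne⟩ := hi
  refine Matrix.det_zero_of_row_eq hne ?_
  ext c
  rw [Matrix.submatrix_apply, Matrix.submatrix_apply, h]

/-- Expanding every row in the standard basis by multilinearity sums over all maps j, not only
permutations, which is the index set used in the relation `det`. -/
theorem det_eq_sum_leviCivita (g : Matrix (Fin N) (Fin N) ℂ) :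
    g.det = ∑ j : Fin N → Fin N, (∏ k, g k (j k)) * leviCivita j := by
  have h : g = fun k => ∑ j, g k j • (1 : Matrix (Fin N) (Fin N) ℂ) j := by
    funext k l
    simp [Matrix.one_apply]
  calc g.det = Matrix.detRowAlternating.toMultilinearMap
        (fun k => ∑ j, g k j • (1 : Matrix (Fin N) (Fin N) ℂ) j) := by
        rw [← h]; rfl
    _ = _ := by
        rw [MultilinearMap.map_sum]
        refine Finset.sum_congr rfl fun j _ => ?_
        rw [MultilinearMap.map_smul_univ]
        rfl

theorem sum_leviCivita_mul_prod (g : Matrix (Fin N) (Fin N) ℂ) (i : Fin N → Fin N) :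
    ∑ j, leviCivita j * ∏ k, g (i k) (j k) = leviCivita i * g.det := by
  have h : g.submatrix i id = (1 : Matrix (Fin N) (Fin N) ℂ).submatrix i id * g := by
    ext a b
    simp [Matrix.mul_apply, Matrix.one_apply]
  rw [leviCivita, ← Matrix.det_mul, ← h, det_eq_sum_leviCivita]
  simp [mul_comm]

theorem update_update_eq_comp_swap {k l : Fin N} (hkl : k ≠ l) (i : Fin N → Fin N) (c d : Fin N) :
    Function.update (Function.update i k d) l c =
      Function.update (Function.update i k c) l d ∘ Equiv.swap k l := by
  funext m
  rcases eq_or_ne m k with rfl | h1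
  · simp [hkl]
  · rcases eq_or_ne m l with rfl | h2
    · simp [hkl]
    · simp [Equiv.swap_apply_of_ne_of_ne h1 h2, h1, h2]

theorem comp_swap_eq_update {k l : Fin N} (hkl : k ≠ l) (i : Fin N → Fin N) :
    Function.update (Function.update i k (i l)) l (i k) = i ∘ Equiv.swap k l := by
  rw [update_update_eq_comp_swap hkl]
  simp

theorem sum_Rmat_classical (a b : Fin N) (v : Fin N → Fin N → ℂ) :
    ∑ c, ∑ d, Rmat 1 N a b c d * v c d = v a b := by
  simp [Rmat_classical, ite_and]

/-- At s = 1 the operator R̂ is the flip and its eigenvalue -1, so the first condition is ordinary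
antisymmetry. The trace condition then follows because C is symmetric. -/
theorem isQEpsilon_leviCivita : IsQEpsilon 1 N leviCivita := by
  have hne (k : ℕ) (hk : k + 1 < N) : (⟨k, Nat.lt_of_succ_lt hk⟩ : Fin N) ≠ ⟨k + 1, hk⟩ := by
    simp [Fin.ext_iff]
  constructor
  · intro k hk i
    rw [sum_Rmat_classical, comp_swap_eq_update (hne k hk), leviCivita_comp_perm,
      Equiv.Perm.sign_swap (hne k hk)]
    simp [qpar]
  · intro k hk i
    -- Exchanging c and d keeps C and changes the sign of the symbol, so the contraction equals its
    -- own negative.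
    rw [← self_eq_neg]
    conv_lhs => rw [Finset.sum_comm]
    simp only [← Finset.sum_neg_distrib]
    refine Finset.sum_congr rfl fun c _ => Finset.sum_congr rfl fun d _ => ?_
    have hC : metric 1 N d c = metric 1 N c d :=
      congrFun (congrFun metric_classical_transpose c) d
    rw [update_update_eq_comp_swap (hne k hk), leviCivita_comp_perm,
      Equiv.Perm.sign_swap (hne k hk), hC]
    simp

/-- The defining condition gives the sign rule for adjacent transpositions, and these generate the
symmetric group. -/
theorem IsQEpsilon.comp_perm {ε : (Fin N → Fin N) → ℂ} (hε : IsQEpsilon 1 N ε)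
    (i : Fin N → Fin N) (σ : Equiv.Perm (Fin N)) :
    ε (i ∘ σ) = (Equiv.Perm.sign σ : ℂ) * ε i := by
  obtain _ | n := N
  · simp [Subsingleton.elim σ 1]
  · have hσ : σ ∈ Submonoid.closure
        (Set.range fun k : Fin n => Equiv.swap k.castSucc k.succ) := by
      rw [Equiv.Perm.mclosure_swap_castSucc_succ]; trivial
    induction hσ using Submonoid.closure_induction generalizing i with
    | mem σ h =>
      obtain ⟨k, rfl⟩ := h
      have hne : k.castSucc ≠ k.succ := Fin.castSucc_lt_succ.ne
      have := hε.antisymm k (by lia) i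
      rw [sum_Rmat_classical] at this
      change ε (Function.update (Function.update i k.castSucc _) k.succ _) = _ at this
      rw [Equiv.Perm.sign_swap hne, ← comp_swap_eq_update hne]
      refine this.trans ?_
      simp [qpar]
    | one => simp
    | mul σ τ _ _ hσ hτ =>
      rw [Equiv.Perm.coe_mul, ← Function.comp_assoc, hτ, hσ, Equiv.Perm.sign_mul]
      push_cast
      ring

/-- An alternating tensor with as many slots as dimensions is determined by its value on the
identity multi-index. The determinant relations at s = 1 are therefore all consequences of one. -/
theorem IsQEpsilon.eq_leviCivita {ε : (Fin N → Fin N) → ℂ} (hε : IsQEpsilon 1 N ε)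
    (i : Fin N → Fin N) : ε i = leviCivita i * ε id := by
  by_cases hi : Function.Injective i
  · obtain ⟨σ, rfl⟩ : ∃ σ : Equiv.Perm (Fin N), i = σ :=
      ⟨Equiv.ofBijective i (Finite.injective_iff_bijective.1 hi), rfl⟩
    have h1 := hε.comp_perm id σ
    have h2 := leviCivita_comp_perm id σ
    rw [Function.id_comp] at h1 h2
    rw [h1, h2, leviCivita_id, mul_one]
  · rw [leviCivita_of_not_injective hi, zero_mul]
    simp only [Function.Injective, not_forall] at hi
    obtain ⟨a, b, h, hne⟩ := hi
    have h1 := hε.comp_perm i (Equiv.swap a b)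
    have h2 : i ∘ Equiv.swap a b = i := by
      rw [← comp_swap_eq_update hne, h]
      simp [← h]
    rw [h2, Equiv.Perm.sign_swap hne] at h1
    exact self_eq_neg.1 (by simpa using h1)

theorem metricB_complex (s : ℂˣ) (N : ℕ) : metricB s N ℂ = metric s N := rfl

/-- Complex points of the classical group. -/
theorem isQOrth_classical_iff (g : Matrix (Fin N) (Fin N) ℂ) :
    IsQOrth 1 g ↔ g.transpose * metric 1 N * g = metric 1 N ∧ g.det = 1 := by
  have htens (i j : Fin N → Fin N) : tens g i j = ∏ k, g (i k) (j k) := List.prod_ofFn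
  constructor
  · intro h
    refine ⟨?_, ?_⟩
    · have := (orth₂_iff g).1 h.orth₂
      rwa [metricB_complex, ← mul_assoc] at this
    -- The Levi-Civita symbol at the identity multi-index turns the determinant relation into det g
    -- = 1.
    · have := h.det _ isQEpsilon_leviCivita id
      simp only [htens, smul_eq_mul, mul_one] at this
      rw [sum_leviCivita_mul_prod, leviCivita_id, one_mul] at this
      exact this
  · rintro ⟨h1, h2⟩
    refine ⟨fun a b c d => ?_, ?_, ?_, fun ε hε i => ?_⟩
    · simp only [Rmat_classical, ite_and, smul_eq_mul, ite_mul, one_mul, zero_mul]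
      simp [mul_comm]
    · rw [orth₁_iff, metricB_complex]
      -- Over a field the left inverse C gᵗ C of g is also a right inverse, so one orthogonality
      -- relation implies the other.
      have h3 : metric 1 N * g.transpose * metric 1 N * g = 1 := by
        rw [mul_assoc, mul_assoc, ← mul_assoc g.transpose, h1, metric_mul_metric]
      have h4 := mul_eq_one_comm.1 h3
      calc _ = g * (metric 1 N * g.transpose * metric 1 N) * metric 1 N := by
            simp only [mul_assoc, metric_mul_metric, mul_one]
        _ = _ := by rw [h4, one_mul]
    · rw [orth₂_iff, metricB_complex, ← mul_assoc, h1]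
    · simp only [htens, smul_eq_mul, mul_one]
      rw [hε.eq_leviCivita i, ← mul_one (leviCivita i), ← h2, ← sum_leviCivita_mul_prod,
        Finset.sum_mul]
      refine Finset.sum_congr rfl fun j _ => ?_
      rw [hε.eq_leviCivita j]
      ring

end Classical

/-! ### Real points from an orthonormal basis fixed by the conjugation -/

section RealPoints

variable {N : ℕ}

theorem indefiniteDiagonal_mul_self (l m : ℕ) :
    LieAlgebra.Orthogonal.indefiniteDiagonal (Fin l) (Fin m) ℂ *
      LieAlgebra.Orthogonal.indefiniteDiagonal (Fin l) (Fin m) ℂ = 1 := by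
  rw [LieAlgebra.Orthogonal.indefiniteDiagonal, Matrix.diagonal_mul_diagonal,
    ← Matrix.diagonal_one]
  congr 1
  funext i
  rcases i with i | i <;> simp

theorem map_indefiniteDiagonal (l m : ℕ) :
    (LieAlgebra.Orthogonal.indefiniteDiagonal (Fin l) (Fin m) ℝ).map Complex.ofReal =
      LieAlgebra.Orthogonal.indefiniteDiagonal (Fin l) (Fin m) ℂ := by
  ext i j
  rcases i with i | i <;> rcases j with j | j <;>
    simp [LieAlgebra.Orthogonal.indefiniteDiagonal, Matrix.diagonal_apply] <;>
    split_ifs <;> simp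

theorem mem_SOlm_iff {l m : ℕ} (h : Matrix (Fin l ⊕ Fin m) (Fin l ⊕ Fin m) ℝ) :
    h ∈ SOlm l m ↔ (h.map Complex.ofReal).transpose *
        LieAlgebra.Orthogonal.indefiniteDiagonal (Fin l) (Fin m) ℂ * h.map Complex.ofReal =
      LieAlgebra.Orthogonal.indefiniteDiagonal (Fin l) (Fin m) ℂ ∧
      (h.map Complex.ofReal).det = 1 := by
  have hdet : (h.map Complex.ofReal).det = (h.det : ℂ) := (RingHom.map_det Complex.ofRealHom h).symm
  have hmul : (h.map Complex.ofReal).transpose *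
      LieAlgebra.Orthogonal.indefiniteDiagonal (Fin l) (Fin m) ℂ * h.map Complex.ofReal =
      (h.transpose * LieAlgebra.Orthogonal.indefiniteDiagonal (Fin l) (Fin m) ℝ * h).map
        Complex.ofReal := by
    have hm (A B : Matrix (Fin l ⊕ Fin m) (Fin l ⊕ Fin m) ℝ) :
        (A * B).map Complex.ofReal = A.map Complex.ofReal * B.map Complex.ofReal :=
      Matrix.map_mul (f := Complex.ofRealHom)
    rw [← map_indefiniteDiagonal, ← Matrix.transpose_map, hm, hm]
  rw [hdet, hmul, ← map_indefiniteDiagonal, Complex.ofReal_eq_one]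
  exact and_congr_left' (Matrix.map_injective Complex.ofReal_injective).eq_iff.symm

/-- A character that intertwines a star structure with complex conjugation on the generators does
so everywhere. -/
theorem char_star {s : ℂˣ} (σ : HopfStar (SOq s N)) (χ : SOq s N →ₐ[ℂ] ℂ)
    (h : ∀ a b, χ (σ (T s N a b)) = starRingEnd ℂ (χ (T s N a b))) (f : SOq s N) :
    χ (σ f) = starRingEnd ℂ (χ f) := by
  induction f using SOq.induction with
  | alg r => rw [σ.map_algebraMap]; simp
  | gen a b => exact h a b
  | add x y hx hy => simp only [map_add, hx, hy]
  | mul x y hx hy => rw [σ.antimul, map_mul, hx, hy, map_mul, map_mul, mul_comm]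

/-- The columns of M' are fixed by v ↦ E v̄. In the coordinates they define, the reality condition
on g, that its conjugate be E g E, says that the matrix is real, and C becomes diagonal with entries
±1. -/
theorem isClassicalForm_of_basis {σ : HopfStar (SOq 1 N)} {E : Matrix (Fin N) (Fin N) ℂ}
    (hE : E * E = 1) (hσ : ActsBy σ E) {l m : ℕ} (hN : l + m = N)
    (M' : Matrix (Fin N) (Fin l ⊕ Fin m) ℂ)
    (hM : M'.transpose * metric 1 N * M' =
      LieAlgebra.Orthogonal.indefiniteDiagonal (Fin l) (Fin m) ℂ)
    (hM' : M'.map (starRingEnd ℂ) = E * M') : σ.IsClassicalForm l m := by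
  have hJ := indefiniteDiagonal_mul_self l m
  have hJt : (LieAlgebra.Orthogonal.indefiniteDiagonal (Fin l) (Fin m) ℂ).transpose =
      LieAlgebra.Orthogonal.indefiniteDiagonal (Fin l) (Fin m) ℂ := Matrix.diagonal_transpose _
  set J := LieAlgebra.Orthogonal.indefiniteDiagonal (Fin l) (Fin m) ℂ with hJdef
  -- Since M'ᵗ C M' = J and J² = 1, this is the inverse of M' in closed form.
  obtain ⟨M, hMdef⟩ : ∃ M, M = J * (M'.transpose * metric 1 N) := ⟨_, rfl⟩
  have h1 : M * M' = 1 := by rw [hMdef, Matrix.mul_assoc, hM, hJ]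
  have h2 : M' * M = 1 := (Matrix.mul_eq_one_comm_of_card_eq _ _ _ (by simp [hN])).1 h1
  have h3 : M.transpose * J * M = metric 1 N := by
    rw [hMdef, Matrix.transpose_mul, Matrix.transpose_mul, Matrix.transpose_transpose, hJt,
      metric_classical_transpose]
    calc metric 1 N * M' * J * J * (J * (M'.transpose * metric 1 N))
        = metric 1 N * (M' * ((J * J) * (J * (M'.transpose * metric 1 N)))) := by
          simp only [Matrix.mul_assoc]
      _ = metric 1 N := by rw [hJ, Matrix.one_mul, ← hMdef, h2, Matrix.mul_one]
  -- Conjugating M M' = 1 shows that the conjugate of M is a left inverse of E M', while M E is its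
  -- inverse.
  have h4 : M.map (starRingEnd ℂ) = M * E := by
    have h5 : M.map (starRingEnd ℂ) * (E * M') = 1 := by
      rw [← hM', ← Matrix.map_mul, h1]
      simp
    calc M.map (starRingEnd ℂ) = M.map (starRingEnd ℂ) * (E * (M' * M) * E) := by
          rw [h2, Matrix.mul_one, hE, Matrix.mul_one]
      _ = (M.map (starRingEnd ℂ) * (E * M')) * M * E := by simp only [Matrix.mul_assoc]
      _ = M * E := by rw [h5, Matrix.one_mul]
  have hEinv : E⁻¹ = E := Matrix.inv_eq_right_inv hE
  have hreal (χ : SOq 1 N →ₐ[ℂ] ℂ) (a b : Fin N) :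
      χ (σ (T 1 N a b)) = (E * (T 1 N).map χ * E) a b := by
    rw [hσ, hEinv]
    simp only [map_sum, map_smul, Matrix.mul_apply, Finset.sum_mul, Matrix.map_apply, smul_eq_mul]
    rw [Finset.sum_comm]
    exact Finset.sum_congr rfl fun c _ => Finset.sum_congr rfl fun d _ => by ring
  refine ⟨M, M', h1, h2, hM, Set.ext fun g => ⟨?_, ?_⟩⟩
  · rintro ⟨χ, hχ, hg⟩
    have hg' : (T 1 N).map χ = g := Matrix.ext hg
    obtain ⟨g1, g2⟩ := (isQOrth_classical_iff g).1 (hg' ▸ (isQOrth_T 1 N).map χ)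
    have g3 : g.map (starRingEnd ℂ) = E * g * E := by
      ext a b
      rw [Matrix.map_apply, ← hg, ← hχ, hreal, hg']
    have h5 : (M * g * M').map (starRingEnd ℂ) = M * g * M' := by
      rw [Matrix.map_mul, Matrix.map_mul, g3, h4, hM']
      calc M * E * (E * g * E) * (E * M') = M * (E * E) * g * (E * E) * M' := by
            simp only [Matrix.mul_assoc]
        _ = _ := by rw [hE, Matrix.mul_one, Matrix.mul_one]
    -- The entries are self-conjugate by `h5`, so taking real parts loses nothing.
    obtain ⟨h, hh⟩ : ∃ h : Matrix (Fin l ⊕ Fin m) (Fin l ⊕ Fin m) ℝ,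
        h.map Complex.ofReal = M * g * M' := by
      refine ⟨(M * g * M').map Complex.re, ?_⟩
      ext i j
      rw [Matrix.map_apply, Matrix.map_apply]
      exact Complex.conj_eq_iff_re.1 (congrFun (congrFun h5 i) j)
    refine ⟨h, (mem_SOlm_iff h).2 ⟨?_, ?_⟩, ?_⟩
    · rw [hh, Matrix.transpose_mul, Matrix.transpose_mul]
      calc M'.transpose * (g.transpose * M.transpose) * J * (M * g * M')
          = M'.transpose * (g.transpose * (M.transpose * J * M) * g) * M' := by
            simp only [Matrix.mul_assoc]
        _ = J := by rw [h3, g1, hM]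
    · rw [hh, Matrix.det_conj_of_mul_eq_one h1 h2, g2]
    · change M' * h.map Complex.ofReal * M = g
      rw [hh]
      calc M' * (M * g * M') * M = (M' * M) * g * (M' * M) := by simp only [Matrix.mul_assoc]
        _ = g := by rw [h2, Matrix.one_mul, Matrix.mul_one]
  · rintro ⟨h, hh, rfl⟩
    rw [mem_SOlm_iff, ← hJdef] at hh
    change M' * h.map Complex.ofReal * M ∈ σ.realPoints
    have hconj : (h.map Complex.ofReal).map (starRingEnd ℂ) = h.map Complex.ofReal := by
      ext i j; simp
    obtain ⟨k1, k2⟩ := hh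
    generalize h.map Complex.ofReal = k at k1 k2 hconj
    have hg : IsQOrth 1 (M' * k * M) := by
      refine (isQOrth_classical_iff _).2 ⟨?_, ?_⟩
      · rw [Matrix.transpose_mul, Matrix.transpose_mul]
        calc M.transpose * (k.transpose * M'.transpose) * metric 1 N * (M' * k * M)
            = M.transpose * (k.transpose * (M'.transpose * metric 1 N * M') * k) * M := by
              simp only [Matrix.mul_assoc]
          _ = _ := by rw [hM, k1, h3]
      · rw [Matrix.det_conj_of_mul_eq_one h2 h1, k2]
    refine ⟨SOq.lift hg, char_star σ _ fun a b => ?_, SOq.lift_T hg⟩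
    have hT : (T 1 N).map (SOq.lift hg) = M' * k * M := Matrix.ext (SOq.lift_T hg)
    have key : (M' * k * M).map (starRingEnd ℂ) = E * (M' * k * M) * E := by
      rw [Matrix.map_mul, Matrix.map_mul, hM', h4, hconj]
      simp only [Matrix.mul_assoc]
    rw [hreal, hT, ← key, SOq.lift_T]
    rfl

/-- The vector `x e_a + y e_{a'}`. -/
def pairVec (a : Fin N) (x y : ℂ) (c : Fin N) : ℂ :=
  (if c = a then x else 0) + if c = a.rev then y else 0

/-- C pairs c with c', so vectors from different pairs are orthogonal. For a self-paired index both
conditions hold at once and the contributions add up to (x + y)(z + w). -/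
theorem sum_pairVec (a b : Fin N) (x y z w : ℂ) :
    ∑ c, pairVec a x y c * pairVec b z w c.rev =
      (if a = b then x * w + y * z else 0) + if a.rev = b then x * z + y * w else 0 := by
  simp only [pairVec, add_mul, ite_mul, zero_mul, Finset.sum_add_distrib, Finset.sum_ite_eq',
    Finset.mem_univ, if_true, Fin.rev_rev, Fin.rev_inj]
  split_ifs <;> ring

theorem pairVec_gram {ι : Type*} [Fintype ι] (a : ι → Fin N) (x y : ι → ℂ) (i j : ι) :
    ((Matrix.of fun c i => pairVec (a i) (x i) (y i) c).transpose * metric 1 N *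
      (Matrix.of fun c i => pairVec (a i) (x i) (y i) c)) i j =
      (if a i = a j then x i * y j + y i * x j else 0) +
        if (a i).rev = a j then x i * x j + y i * y j else 0 := by
  rw [← sum_pairVec, Matrix.mul_assoc, Matrix.mul_apply]
  refine Finset.sum_congr rfl fun c _ => ?_
  simp [Matrix.mul_apply, metric_classical]

theorem sharpMatrix_mul_pairVec {ι : Type*} [Fintype ι] (a : ι → Fin N) (x y : ι → ℂ)
    (c : Fin N) (i : ι) :
    (sharpMatrix N * (Matrix.of fun c i => pairVec (a i) (x i) (y i) c)) c i =
      sharpWeight N c * pairVec (a i) (x i) (y i) (sharpPerm N c) := by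
  rw [← monomialMatrix_sharp]
  simp [Matrix.mul_apply, monomialMatrix]

theorem sharpMatrix_mul_self : sharpMatrix N * sharpMatrix N = 1 := by
  rw [← monomialMatrix_sharp]
  ext a b
  rw [Matrix.mul_apply, Finset.sum_eq_single (sharpPerm N a)]
  · by_cases h : a = b
    · subst h
      simp [monomialMatrix, sharpPerm_sharpPerm, sharpWeight_sharpPerm, sharpWeight_mul_self]
    · simp [monomialMatrix, sharpPerm_sharpPerm, h, Ne.symm h]
  · intro c _ hc; simp [monomialMatrix, hc]
  · simp

end RealPoints

/-! ### Explicit bases and their signatures -/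

section Signatures

variable {N : ℕ}

theorem conj_two : starRingEnd ℂ 2 = 2 := map_ofNat _ 2

theorem conj_pairVec_of_real (a : Fin N) {x y : ℂ} (hx : starRingEnd ℂ x = x)
    (hy : starRingEnd ℂ y = y) (c : Fin N) :
    starRingEnd ℂ (pairVec a x y c) = pairVec a x y c := by
  unfold pairVec
  split_ifs <;> simp [hx, hy]

theorem pairVec_rev (a : Fin N) (x y : ℂ) (c : Fin N) :
    pairVec a x y c.rev = pairVec a y x c := by
  have h1 : c.rev = a ↔ c = a.rev := ⟨fun h => by simp [← h], fun h => by simp [h]⟩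
  simp only [pairVec, h1, Fin.rev_inj]
  ring

theorem pairVec_of_not_middle {a c : Fin N} (h : ¬ (IsMiddle a ↔ IsMiddle c)) (x y : ℂ) :
    pairVec a x y c = 0 := by
  have h1 : c ≠ a := by rintro rfl; exact h Iff.rfl
  have h2 : c ≠ a.rev := by rintro rfl; exact h isMiddle_rev.symm
  simp [pairVec, h1, h2]

/-- Choosing each basis vector in the span of one e_a and e_{a'} reduces the Gram matrix to scalar
conditions on the coefficients x and y. -/
theorem isClassicalForm_of_pairs {σ : HopfStar (SOq 1 N)} {E : Matrix (Fin N) (Fin N) ℂ}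
    (hE : E * E = 1) (hσ : ActsBy σ E) {l m : ℕ} (hN : l + m = N)
    (a : Fin l ⊕ Fin m → Fin N) (x y : Fin l ⊕ Fin m → ℂ)
    (hgram : ∀ i j, ((if a i = a j then x i * y j + y i * x j else 0) +
        if (a i).rev = a j then x i * x j + y i * y j else 0) =
      LieAlgebra.Orthogonal.indefiniteDiagonal (Fin l) (Fin m) ℂ i j)
    (hconj : ∀ c i, starRingEnd ℂ (pairVec (a i) (x i) (y i) c) =
      (E * (Matrix.of fun c i => pairVec (a i) (x i) (y i) c)) c i) :
    σ.IsClassicalForm l m := by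
  refine isClassicalForm_of_basis hE hσ hN (Matrix.of fun c i => pairVec (a i) (x i) (y i) c)
    ?_ ?_
  · ext i j
    rw [pairVec_gram, hgram]
  · ext c i
    rw [← hconj]
    rfl

theorem cross_isClassicalForm (hs : ‖((1 : ℂˣ) : ℂ)‖ = 1) {l m : ℕ} (hN : l + m = N)
    (a : Fin l ⊕ Fin m → Fin N) (x y : Fin l ⊕ Fin m → ℂ)
    (hgram : ∀ i j, ((if a i = a j then x i * y j + y i * x j else 0) +
        if (a i).rev = a j then x i * x j + y i * y j else 0) =
      LieAlgebra.Orthogonal.indefiniteDiagonal (Fin l) (Fin m) ℂ i j)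
    (hx : ∀ i, starRingEnd ℂ (x i) = x i) (hy : ∀ i, starRingEnd ℂ (y i) = y i) :
    (cross N hs).IsClassicalForm l m := by
  refine isClassicalForm_of_pairs (Matrix.one_mul 1) (cross_actsBy hs) hN a x y hgram fun c i => ?_
  rw [Matrix.one_mul, conj_pairVec_of_real _ (hx i) (hy i)]
  rfl

theorem crossSharp_actsBy {s : ℂˣ} (hs : ‖(s : ℂ)‖ = 1) :
    ActsBy (crossSharp N hs) (sharpMatrix N) := by
  intro a b
  rw [crossSharp_apply, cross_T]
  exact sharp_actsBy a b

theorem cross_isClassicalForm_odd (n : ℕ) (hs : ‖((1 : ℂˣ) : ℂ)‖ = 1) :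
    (cross (2 * n + 1) hs).IsClassicalForm (n + 1) n := by
  -- The vectors e_k ± ½ e_{k'} have square ±1. At k = n the pair collapses to one vector, so the
  -- coefficients 1 and 0 give e_n itself, of square 1; it supplies the extra plus sign.
  refine cross_isClassicalForm hs (by lia)
    (Sum.elim (fun k => ⟨k, by lia⟩) fun k => ⟨k, by lia⟩) (fun _ => 1)
    (Sum.elim (fun k => if (k : ℕ) < n then 1 / 2 else 0) fun _ => -(1 / 2)) ?_ (by simp) ?_
  · rintro (⟨k, hk⟩ | ⟨k, hk⟩) (⟨l, hl⟩ | ⟨l, hl⟩) <;>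
      simp only [Sum.elim_inl, Sum.elim_inr, LieAlgebra.Orthogonal.indefiniteDiagonal,
        Matrix.diagonal_apply, Fin.ext_iff, Fin.val_rev, Sum.inl.injEq, Sum.inr.injEq,
        reduceCtorEq] <;>
      split_ifs <;> first | (exfalso; lia) | norm_num
  · rintro (k | k)
    · simp only [Sum.elim_inl]
      split_ifs <;> simp [conj_two]
    · simp [conj_two]

theorem cross_isClassicalForm_even (n : ℕ) (hs : ‖((1 : ℂˣ) : ℂ)‖ = 1) :
    (cross (2 * n) hs).IsClassicalForm n n := by
  -- The same vectors e_k ± ½ e_{k'} for k < n; no self-paired index remains.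
  refine cross_isClassicalForm hs (by lia)
    (Sum.elim (fun k => ⟨k, by lia⟩) fun k => ⟨k, by lia⟩) (fun _ => 1)
    (Sum.elim (fun _ => 1 / 2) fun _ => -(1 / 2)) ?_ (by simp) ?_
  · rintro (⟨k, hk⟩ | ⟨k, hk⟩) (⟨l, hl⟩ | ⟨l, hl⟩) <;>
      simp only [Sum.elim_inl, Sum.elim_inr, LieAlgebra.Orthogonal.indefiniteDiagonal,
        Matrix.diagonal_apply, Fin.ext_iff, Fin.val_rev, Sum.inl.injEq, Sum.inr.injEq,
        reduceCtorEq] <;>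
      split_ifs <;> first | (exfalso; lia) | norm_num
  · rintro (k | k) <;> simp [conj_two]

theorem crossSharp_isClassicalForm_odd (n : ℕ) (hs : ‖((1 : ℂˣ) : ℂ)‖ = 1) :
    (crossSharp (2 * n + 1) hs).IsClassicalForm n (n + 1) := by
  have hodd : Odd (2 * n + 1) := ⟨n, rfl⟩
  -- Outside the middle the basis is as for ×. The middle vector must change sign under conjugation,
  -- hence is i e_n, of square -1, and moves to the negative block.
  refine isClassicalForm_of_pairs sharpMatrix_mul_self (crossSharp_actsBy hs) (by lia)
    (Sum.elim (fun k => ⟨k, by lia⟩) fun k => ⟨k, by lia⟩)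
    (Sum.elim (fun _ => 1) fun k => if (k : ℕ) < n then 1 else Complex.I)
    (Sum.elim (fun _ => 1 / 2) fun k => if (k : ℕ) < n then -(1 / 2) else 0) ?_ ?_
  · rintro (⟨k, hk⟩ | ⟨k, hk⟩) (⟨l, hl⟩ | ⟨l, hl⟩) <;>
      simp only [Sum.elim_inl, Sum.elim_inr, LieAlgebra.Orthogonal.indefiniteDiagonal,
        Matrix.diagonal_apply, Fin.ext_iff, Fin.val_rev, Sum.inl.injEq, Sum.inr.injEq,
        reduceCtorEq] <;>
      split_ifs <;> first | (exfalso; lia) | norm_num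
  · have hm (k : ℕ) (hk : k < 2 * n + 1) : IsMiddle (⟨k, hk⟩ : Fin (2 * n + 1)) ↔ k = n := by
      rw [isMiddle_iff_of_odd hodd, Fin.ext_iff, Fin.val_rev]
      lia
    intro c i
    rw [sharpMatrix_mul_pairVec, sharpPerm_of_odd hodd, Equiv.Perm.one_apply]
    by_cases hc : IsMiddle c
    · have hw : sharpWeight (2 * n + 1) c = -1 := by simp [sharpWeight, hc]
      rw [hw]
      rcases i with ⟨k, hk⟩ | ⟨k, hk⟩
      · rw [pairVec_of_not_middle]
        · simp
        · exact fun h => absurd ((hm _ _).1 (h.2 hc)) (by lia)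
      · by_cases hkn : k = n
        · subst hkn
          simp only [Sum.elim_inr, lt_irrefl, if_false, pairVec]
          split_ifs <;> simp
        · rw [pairVec_of_not_middle]
          · simp
          · exact fun h => absurd ((hm _ _).1 (h.2 hc)) hkn
    · have hw : sharpWeight (2 * n + 1) c = 1 := by simp [sharpWeight, hc]
      rw [hw, one_mul]
      rcases i with ⟨k, hk⟩ | ⟨k, hk⟩
      · exact conj_pairVec_of_real _ (by simp) (by simp [conj_two]) c
      · by_cases hkn : k = n
        · rw [pairVec_of_not_middle]
          · simp
          · exact fun h => hc (h.1 ((hm _ _).2 hkn))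
        · have : k < n := by lia
          exact conj_pairVec_of_real _ (by simp [this]) (by simp [this, conj_two]) c

theorem crossSharp_isClassicalForm_even {n : ℕ} (hn : 0 < n) (hs : ‖((1 : ℂˣ) : ℂ)‖ = 1) :
    (crossSharp (2 * n) hs).IsClassicalForm (n + 1) (n - 1) := by
  have heven : Even (2 * n) := ⟨n, by lia⟩
  have hnodd : ¬ Odd (2 * n) := Nat.not_odd_iff_even.2 heven
  -- Conjugation must now exchange the coordinates n - 1 and n. The vectors with coefficients (1 ±
  -- i)/2 and (1 ∓ i)/2 there satisfy this; they are orthogonal and both have square 1, so the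
  -- middle plane is positive. The cap `min k (n - 1)` sends k = n - 1 and k = n to this one pair.
  refine isClassicalForm_of_pairs sharpMatrix_mul_self (crossSharp_actsBy hs) (by lia)
    (Sum.elim (fun k => ⟨min k (n - 1), by lia⟩) fun k => ⟨k, by lia⟩)
    (Sum.elim (fun k => if (k : ℕ) < n - 1 then 1 else
      if (k : ℕ) = n then (1 - Complex.I) / 2 else (1 + Complex.I) / 2) fun _ => 1)
    (Sum.elim (fun k => if (k : ℕ) < n - 1 then 1 / 2 else
      if (k : ℕ) = n then (1 + Complex.I) / 2 else (1 - Complex.I) / 2) fun _ => -(1 / 2)) ?_ ?_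
  · rintro (⟨k, hk⟩ | ⟨k, hk⟩) (⟨l, hl⟩ | ⟨l, hl⟩) <;>
      simp only [Sum.elim_inl, Sum.elim_inr, LieAlgebra.Orthogonal.indefiniteDiagonal,
        Matrix.diagonal_apply, Fin.ext_iff, Fin.val_rev, Sum.inl.injEq, Sum.inr.injEq,
        reduceCtorEq] <;>
      split_ifs <;> first | (exfalso; lia) | (norm_num; done) | (ring_nf; norm_num [Complex.I_sq])
  · have hm (k : ℕ) (hk : k < 2 * n) : IsMiddle (⟨k, hk⟩ : Fin (2 * n)) ↔ k = n ∨ k + 1 = n :=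
      isMiddle_iff_of_even rfl
    intro c i
    have hw : sharpWeight (2 * n) c = 1 := by simp [sharpWeight, hnodd]
    rw [sharpMatrix_mul_pairVec, hw, one_mul]
    by_cases hc : IsMiddle c
    · rw [sharpPerm_of_isMiddle heven hc, pairVec_rev]
      rcases i with ⟨k, hk⟩ | ⟨k, hk⟩
      · by_cases hkn : k < n - 1
        · rw [pairVec_of_not_middle, pairVec_of_not_middle]
          · simp
          all_goals exact fun h => absurd ((hm _ _).1 (h.2 hc)) (by lia)
        · simp only [Sum.elim_inl, hkn, if_false]
          by_cases hkn' : k = n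
          · simp only [hkn', if_true, pairVec]
            split_ifs <;> simp [conj_two, sub_eq_add_neg]
          · simp only [hkn', if_false, pairVec]
            split_ifs <;> simp [conj_two, sub_eq_add_neg]
      · rw [pairVec_of_not_middle, pairVec_of_not_middle]
        · simp
        all_goals exact fun h => absurd ((hm _ _).1 (h.2 hc)) (by lia)
    · rw [sharpPerm_of_not_isMiddle hc]
      rcases i with ⟨k, hk⟩ | ⟨k, hk⟩
      · by_cases hkn : k < n - 1
        · exact conj_pairVec_of_real _ (by simp [hkn]) (by simp [hkn, conj_two]) c
        · rw [pairVec_of_not_middle]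
          · simp
          · exact fun h => hc (h.1 ((hm _ _).2 (by lia)))
      · exact conj_pairVec_of_real _ (by simp) (by simp [conj_two]) c

end Signatures

end

end QuantumOrthogonal

open QuantumOrthogonal in
/-- The `|q| = 1` real forms of `SO_q(N)`, `N > 2`, `q = s²`. Here `cross` is the conjugation `×`,
and `crossSharp`, `crossNat`, `crossSharpNat` are `×^♯`, `×^♮`, `×^{♯♮}`. All maps are determined
by their values on the generators. -/
theorem mainTheorem3 (N : ℕ) (hN : 2 < N) (s : ℂˣ) (hs : ‖(s : ℂ)‖ = 1) :
    ∃ (cross crossSharp : HopfStar (SOq s N)) (sharp : HopfAut (SOq s N)),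
      -- `T^× = T`, `T^♯ = 𝒟 T 𝒟⁻¹`, and `×^♯ = ♯ ∘ × = × ∘ ♯`
      ActsBy cross 1 ∧
      ActsBy sharp (sharpMatrix N) ∧
      (∀ x, sharp (sharp x) = x) ∧
      (∀ x, crossSharp x = sharp (cross x)) ∧
      (∀ x, crossSharp x = cross (sharp x)) ∧
      -- the names of the real forms: their classical limits
      (∀ n, N = 2 * n + 1 → s = 1 →
        cross.IsClassicalForm (n + 1) n ∧ crossSharp.IsClassicalForm n (n + 1)) ∧
      (∀ n, N = 2 * n → s = 1 →
        cross.IsClassicalForm n n ∧ crossSharp.IsClassicalForm (n + 1) (n - 1)) ∧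
      -- for odd `N`: `α ∘ ×^♯ = × ∘ α`, so `SO_q(n, n+1)` is isomorphic to `SO_q(n+1, n)`
      (Odd N →
        (∃ alpha : HopfAut (SOq s N), ActsBy alpha (alphaMatrix N) ∧
          ∀ x, alpha (crossSharp x) = cross (alpha x)) ∧
        HopfStar.Equivalent crossSharp cross) ∧
      -- `×^♮` is equivalent to `×`, and `×^{♯♮}` is equivalent to `×^♯`, by the diagonal automorphism
      -- `beta`; for odd `N`, `×^{♯♮}` is equivalent to `×` as well
      (∀ ε : Fin N → ℂ, IsSigns ε →
        ∃ (natural beta : HopfAut (SOq s N)) (crossNat crossSharpNat : HopfStar (SOq s N)),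
          ActsBy natural (Matrix.diagonal ε) ∧
          (∀ x, natural (natural x) = x) ∧
          (∀ x, natural (sharp x) = sharp (natural x)) ∧
          (∀ x, crossNat x = natural (cross x)) ∧
          (∀ x, crossNat x = cross (natural x)) ∧
          (∀ x, crossSharpNat x = natural (sharp (cross x))) ∧
          (∀ x, crossSharpNat x = cross (natural (sharp x))) ∧
          ActsBy beta (sigmaMatrix ε) ∧
          (∀ x, beta (crossNat x) = cross (beta x)) ∧
          (∀ x, beta (crossSharpNat x) = crossSharp (beta x)) ∧
          HopfStar.Equivalent crossNat cross ∧
          HopfStar.Equivalent crossSharpNat crossSharp ∧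
          (Odd N → HopfStar.Equivalent crossSharpNat cross)) := by
  refine ⟨cross N hs, crossSharp N hs, sharp s N, cross_actsBy hs, sharp_actsBy, sharp_sharp,
    fun _ => rfl, sharp_cross hs, ?_, ?_, fun hodd => ⟨exists_alpha hs hodd, ?_⟩, fun ε hε => ?_⟩
  · rintro n rfl rfl
    exact ⟨cross_isClassicalForm_odd n hs, crossSharp_isClassicalForm_odd n hs⟩
  · rintro n rfl rfl
    exact ⟨cross_isClassicalForm_even n hs, crossSharp_isClassicalForm_even (by lia) hs⟩
  · obtain ⟨α, -, hα⟩ := exists_alpha hs hodd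
    exact HopfStar.equivalent_of_comm α hα
  · obtain ⟨natural, beta, crossNat, crossSharpNat, h1, h2, h3, h4, h5, h6, h7, h8, h9, h10⟩ :=
      exists_natural hs hε
    refine ⟨natural, beta, crossNat, crossSharpNat, h1, h2, h3, h4, h5, h6, h7, h8, h9, h10,
      HopfStar.equivalent_of_comm beta h9, HopfStar.equivalent_of_comm beta h10, fun hodd => ?_⟩
    obtain ⟨α, -, hα⟩ := exists_alpha hs hodd
    -- β takes ×^{♯♮} to ×^♯, and for odd N α takes ×^♯ to ×.
    exact (HopfStar.equivalent_of_comm beta h10).trans (HopfStar.equivalent_of_comm α hα)
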